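/- **Setting.** Let $n\ge 1$, $A\in\mathbb R^{n\times n}$, $b,c\in\mathbb R^n$ with $(A,b)$ controllable, let $\Omega\subset\mathbb R^n$ be compact and convex and $\theta\in\Omega$ (the unknown parameter). Consider the plant $$\dot x(t)=Ax(t)+b\,(u(t)-\theta^\top x(t)),\quad x(0)=x_0,\qquad y(t)=c^\top x(t),\qquad t\ge 0 .$$ Let $K\in\mathbb R^n$ be such that $A_m=A-bK^\top$ is Hurwitz, $Q$ symmetric positive definite, $P$ the solution of $A_m^\top P+PA_m=-Q$, $C(s)$ a stable strictly proper rational transfer function with $C(0)=1$, $\Gamma_c>0$, $r:[0,\infty)\to\mathbb R$ bounded and continuous, $H_o(s)=(sI-A_m)^{-1}b$ and $k_g=1/(c^\top H_o(0))$. The $\mathcal L_1$ adaptive controller is $$u=-K^\top x+u_2,\qquad u_2(s)=C(s)\big(\bar r(s)+k_g r(s)\big),\quad \bar r(t)=\hat\theta(t)^\top x(t),$$ $$\dot{\hat x}=A_m\hat x-b\,\hat\theta^\top x+b\,u_2,\quad \hat x(0)=x_0,\qquad \dot{\hat\theta}=\Gamma_c\,\mathrm{Proj}\big(\hat\theta,\;x\,(\hat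 x-x)^\top Pb\big),\quad \hat\theta(0)=\hat\theta_0\in\Omega,$$ where $v(s)=C(s)w(s)$ means that $v$ is the convolution of $w$ with the impulse response of $C$, and $\mathrm{Proj}(\vartheta,\cdot)$ is the Euclidean projection onto the tangent cone of $\Omega$ at $\vartheta$ (the equation for $\hat\theta$ holds in the sense of Carathéodory). The reference system is the same plant, with state $x_{ref}$, $x_{ref}(0)=x_0$, output $y_{ref}=c^\top x_{ref}$, and control $$u_{ref}(s)=C(s)\big(k_g r(s)+\eta(s)\big)-K^\top x_{ref}(s),\qquad \eta(t)=\theta^\top x_{ref}(t).$$ **Norms and constants.** For a signal $\xi$ on $[0,\infty)$, $\|\xi\|_{\mathcal L_\infty}=\max_i\sup_{t\ge0}|\xi_i(t)|$. The $\mathcal L_1$ gain of a scalar stable proper system with impulse response $d\,\delta(t)+h(t)$ is $|d|+\int_0^\infty|h(t)|\,dt$, and $\|H(s)\|_{\mathcal L_1}=\max_i\sum_j\|H_{ij}(s)\|_{\mathcal L_1}$ for a matrix of such systems. Let $$\bar G(s)=H_o(s)(C(s)-1),\qquad H_2(s)=I+(I-\bar G(s)\theta^\top)^{-1}\big(\bar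 G(s)\theta^\top+(C(s)-1)I\big),$$ $\theta_{\max}=\max_{\vartheta\in\Omega}\sum_i|\vartheta_i|$, $\bar\theta_{\max}=\max_{\vartheta\in\Omega}\sum_i4\vartheta_i^2$, and let $\lambda_{\min}(P)$ be the smallest eigenvalue of $P$. **Theorem.** Assume $\|\bar G(s)\|_{\mathcal L_1}\theta_{\max}<1$. Then every trajectory of the closed loop with the $\mathcal L_1$ adaptive controller and of the reference system satisfies $$\|x-x_{ref}\|_{\mathcal L_\infty}\le\frac{\gamma_1}{\sqrt{\Gamma_c}},\qquad \|y-y_{ref}\|_{\mathcal L_\infty}\le\|c^\top\|_{\mathcal L_1}\frac{\gamma_1}{\sqrt{\Gamma_c}},\qquad \gamma_1=\|H_2(s)\|_{\mathcal L_1}\sqrt{\bar\theta_{\max}/\lambda_{\min}(P)}<\infty,$$ where $\|c^\top\|_{\mathcal L_1}=\sum_i|c_i|$ is the $\mathcal L_1$ gain of the constant system $c^\top$. Moreover, there is $c_o\in\mathbb R^n$ such that $c_o^\top H_o(s)=N_n(s)/N_d(s)$ with polynomials $N_n,N_d$ all of whose zeros have negative real part and $\deg N_d=\deg N_n+1$,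 and for every such $c_o$ $$\|u-u_{ref}\|_{\mathcal L_\infty}\le\frac{\gamma_2}{\sqrt{\Gamma_c}},\qquad \gamma_2=\Big\|C(s)\frac{1}{c_o^\top H_o(s)}c_o^\top\Big\|_{\mathcal L_1}\sqrt{\frac{\bar\theta_{\max}}{\lambda_{\min}(P)}}+\big\|C(s)\theta^\top-K^\top\big\|_{\mathcal L_1}\gamma_1<\infty .$$ -/

import Mathlib

open MeasureTheory Set
open scoped Matrix ENNReal

noncomputable section

namespace L1Adaptive

/-! ### Signals, transfer functions and gains -/

/-- The `L∞` norm `max_i sup_{t ≥ 0} |ξ_i(t)|` of a signal on `[0, ∞)`. -/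
def linftyNorm {ι : Type*} (ξ : ℝ → ι → ℝ) : ℝ≥0∞ :=
  ⨆ i, ⨆ t : ℝ, ⨆ _ : 0 ≤ t, ENNReal.ofReal |ξ t i|

/-- The transfer function `F(s)` is stable and proper with impulse response `d δ(t) + h(t)`:
`h` is integrable on `[0, ∞)` and `F(s) = d + ∫₀^∞ e^{-st} h(t) dt` on the closed right
half-plane. The pair `(d, h)` is determined by `F` up to changing `h` on a null set. -/
def IsImpulseResponse (F : ℂ → ℂ) (d : ℝ) (h : ℝ → ℝ) : Prop :=
  IntegrableOn h (Ici 0) ∧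
    ∀ s : ℂ, 0 ≤ s.re → F s = (d : ℂ) + ∫ t in Ici (0 : ℝ), Complex.exp (-s * t) * (h t : ℂ)

/-- The `L₁` gain `|d| + ∫₀^∞ |h(t)| dt` of a single-input single-output system with impulse
response `d δ + h`; it is `∞` when there is no such impulse response, that is, when the system is
not proper and stable. (The infimum is over one pair `(d, h)`, up to null sets.) -/
def sisoL1Gain (F : ℂ → ℂ) : ℝ≥0∞ :=
  ⨅ (d : ℝ) (h : ℝ → ℝ) (_ : IsImpulseResponse F d h),
    ENNReal.ofReal |d| + ∫⁻ t in Ici (0 : ℝ), ENNReal.ofReal |h t|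

/-- The `L₁` gain `max_i ∑_j ‖H_ij‖` of a multi-input multi-output system. -/
def l1Gain {ι κ : Type*} [Fintype κ] (H : ℂ → Matrix ι κ ℂ) : ℝ≥0∞ :=
  ⨆ i, ∑ j, sisoL1Gain (fun s => H s i j)

/-- On `[0, ∞)`, `v` is the response of the system `F(s)` to the input `w` (with zero initial
state), that is `v(s) = F(s) w(s)`: the convolution of `w` with the impulse response of `F`. -/
def IsResponse (F : ℂ → ℂ) (w v : ℝ → ℝ) : Prop :=
  ∃ (d : ℝ) (h : ℝ → ℝ), IsImpulseResponse F d h ∧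
    ∀ t, 0 ≤ t → v t = d * w t + ∫ τ in (0 : ℝ)..t, h (t - τ) * w τ

/-- A stable (Hurwitz) polynomial: all complex zeros in the open left half-plane. -/
def IsStablePoly (p : Polynomial ℝ) : Prop :=
  ∀ z : ℂ, Polynomial.aeval z p = 0 → z.re < 0

/-- A Hurwitz matrix: all complex eigenvalues in the open left half-plane. -/
def IsHurwitz {n : ℕ} (M : Matrix (Fin n) (Fin n) ℝ) : Prop :=
  ∀ z ∈ spectrum ℂ (M.map (algebraMap ℝ ℂ)), z.re < 0

/-- Controllability of `(A, b)`: the matrix `[b, A b, …, A^{n-1} b]` has full rank. -/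
def IsControllable {n : ℕ} (A : Matrix (Fin n) (Fin n) ℝ) (b : Fin n → ℝ) : Prop :=
  (Matrix.of fun i k : Fin n => ((A ^ (k : ℕ)) *ᵥ b) i).rank = n

/-- The minimum eigenvalue of a matrix with real eigenvalues. -/
def lambdaMin {n : ℕ} (P : Matrix (Fin n) (Fin n) ℝ) : ℝ := sInf (spectrum ℝ P)

/-! ### The projection operator -/

/-- The tangent cone of the convex set `Ω` at `θ`. -/
def tangentCone {n : ℕ} (Ω : Set (Fin n → ℝ)) (θ : Fin n → ℝ) : Set (Fin n → ℝ) :=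
  closure {w | ∃ a : ℝ, 0 ≤ a ∧ ∃ z ∈ Ω, w = a • (z - θ)}

/-- `v = Proj(θ, y)`: the vector `v` is the Euclidean projection of `y` onto the tangent cone of
`Ω` at `θ`. -/
def IsProj {n : ℕ} (Ω : Set (Fin n → ℝ)) (θ y v : Fin n → ℝ) : Prop :=
  v ∈ tangentCone Ω θ ∧
    ∀ w ∈ tangentCone Ω θ, ∑ i, (y i - v i) ^ 2 ≤ ∑ i, (y i - w i) ^ 2

/-! ### The plant and the controller -/

/-- The data of the plant (`A`, `b`, `c`, the unknown parameter `θ`, the set `Ω` containing it, the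
initial state `x₀`), of the controller (`K`, `Q`, `P`, the filter `C(s)`, the adaptation gain `Γ_c`,
the initial estimate `θ̂₀`), and the reference signal `r`. -/
structure Setup (n : ℕ) where
  A : Matrix (Fin n) (Fin n) ℝ
  b : Fin n → ℝ
  c : Fin n → ℝ
  θ : Fin n → ℝ
  Ω : Set (Fin n → ℝ)
  x₀ : Fin n → ℝ
  K : Fin n → ℝ
  Q : Matrix (Fin n) (Fin n) ℝ
  P : Matrix (Fin n) (Fin n) ℝ
  filter : RatFunc ℝ
  Γc : ℝ
  θhat₀ : Fin n → ℝ
  r : ℝ → ℝ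

namespace Setup

variable {n : ℕ} (S : Setup n)

/-- `A_m = A - b Kᵀ`. -/
def Am : Matrix (Fin n) (Fin n) ℝ := S.A - Matrix.vecMulVec S.b S.K

/-- The standing assumptions on the data. -/
structure Standing : Prop where
  controllable : IsControllable S.A S.b
  compact : IsCompact S.Ω
  convex : Convex ℝ S.Ω
  θ_mem : S.θ ∈ S.Ω
  hurwitz : IsHurwitz S.Am
  Q_posDef : S.Q.PosDef
  lyapunov : S.Amᵀ * S.P + S.P * S.Am = -S.Q
  filter_strictlyProper : S.filter.num.degree < S.filter.denom.degree
  filter_stable : IsStablePoly S.filter.denom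
  filter_zero : S.filter.eval (RingHom.id ℝ) 0 = 1
  Γc_pos : 0 < S.Γc
  θhat₀_mem : S.θhat₀ ∈ S.Ω
  r_continuous : ContinuousOn S.r (Ici 0)
  r_bounded : ∃ M : ℝ, ∀ t, 0 ≤ t → |S.r t| ≤ M

/-- `C(s)`. -/
def C (s : ℂ) : ℂ := S.filter.eval (algebraMap ℝ ℂ) s

/-- `H_o(s) = (s I - A_m)⁻¹ b`. -/
def Ho (s : ℂ) : Fin n → ℂ :=
  (s • (1 : Matrix (Fin n) (Fin n) ℂ) - S.Am.map (algebraMap ℝ ℂ))⁻¹ *ᵥ fun i => (S.b i : ℂ)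

/-- `k_g = 1 / (cᵀ H_o(0))`, where `H_o(0) = (-A_m)⁻¹ b` is real. (The bounds do not depend on the
value of `k_g`, so nothing is assumed about the denominator.) -/
def kg : ℝ := 1 / (S.c ⬝ᵥ ((-S.Am)⁻¹ *ᵥ S.b))

/-- `Ḡ(s) = H_o(s) (C(s) - 1)`. -/
def Gbar (s : ℂ) : Fin n → ℂ := fun i => S.Ho s i * (S.C s - 1)

/-- `Ḡ(s) θᵀ`. -/
def GbarTheta (s : ℂ) : Matrix (Fin n) (Fin n) ℂ :=
  Matrix.vecMulVec (S.Gbar s) fun i => (S.θ i : ℂ)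

/-- `H₂(s) = I + (I - Ḡ(s) θᵀ)⁻¹ (Ḡ(s) θᵀ + (C(s) - 1) I)`. -/
def H2 (s : ℂ) : Matrix (Fin n) (Fin n) ℂ :=
  1 + (1 - S.GbarTheta s)⁻¹ * (S.GbarTheta s + (S.C s - 1) • 1)

/-- `θ_max = max_{θ ∈ Ω} ∑ |θ_i|`. -/
def thetaMax : ℝ := sSup ((fun ϑ : Fin n → ℝ => ∑ i, |ϑ i|) '' S.Ω)

/-- `θ̄_max = max_{θ ∈ Ω} ∑ 4 θ_i²`. -/
def thetaBarMax : ℝ := sSup ((fun ϑ : Fin n → ℝ => ∑ i, 4 * ϑ i ^ 2) '' S.Ω)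

/-- The `L₁`-gain requirement `‖Ḡ‖ θ_max < 1`. -/
def GainCondition : Prop :=
  l1Gain (fun s => Matrix.replicateCol Unit (S.Gbar s)) * ENNReal.ofReal S.thetaMax < 1

/-- `c_oᵀ H_o(s)`. -/
def coHo (co : Fin n → ℝ) (s : ℂ) : ℂ := (fun i => (co i : ℂ)) ⬝ᵥ S.Ho s

/-- `c_oᵀ H_o(s) = N_n(s) / N_d(s)` with stable polynomials `N_n`, `N_d`, the degree of `N_d` being
one more than the degree of `N_n`. -/
def IsMinPhaseRelDegOne (co : Fin n → ℝ) : Prop :=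
  ∃ Nn Nd : Polynomial ℝ, IsStablePoly Nn ∧ IsStablePoly Nd ∧
    Nd.natDegree = Nn.natDegree + 1 ∧
    ∀ s : ℂ, 0 ≤ s.re → S.coHo co s = Polynomial.aeval s Nn / Polynomial.aeval s Nd

/-- `γ₁ = ‖H₂‖ √(θ̄_max / λ_min(P))`. -/
def γ₁ : ℝ≥0∞ := l1Gain S.H2 * ENNReal.ofReal √(S.thetaBarMax / lambdaMin S.P)

/-- `γ₂ = ‖C (1 / (c_oᵀ H_o)) c_oᵀ‖ √(θ̄_max / λ_min(P)) + ‖C θᵀ - Kᵀ‖ γ₁`. -/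
def γ₂ (co : Fin n → ℝ) : ℝ≥0∞ :=
  l1Gain (fun s => Matrix.replicateRow Unit fun i => S.C s * (1 / S.coHo co s) * (co i : ℂ)) *
      ENNReal.ofReal √(S.thetaBarMax / lambdaMin S.P) +
    l1Gain (fun s => Matrix.replicateRow Unit fun i => S.C s * (S.θ i : ℂ) - (S.K i : ℂ)) * S.γ₁

/-- The `L₁` gain of the constant system `cᵀ`. -/
def cGain : ℝ≥0∞ := l1Gain fun _ => Matrix.replicateRow Unit fun i => (S.c i : ℂ)

/-- The plant `ẋ = A x + b (u - θᵀ x)`, `x(0) = x₀`, on `[0, ∞)`. -/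
def IsPlant (x : ℝ → Fin n → ℝ) (u : ℝ → ℝ) : Prop :=
  x 0 = S.x₀ ∧ ∀ t, 0 ≤ t →
    HasDerivWithinAt x (S.A *ᵥ x t + (u t - S.θ ⬝ᵥ x t) • S.b) (Ici 0) t

/-- The closed loop of the plant with the `L₁` adaptive controller: `x` is the state, `u` the control
signal, `u₂` its adaptive part, `xhat` the state of the predictor, `θhat` the parameter estimate. -/
structure IsClosedLoop (x xhat θhat : ℝ → Fin n → ℝ) (u u₂ : ℝ → ℝ) : Prop where
  plant : S.IsPlant x u
  /-- `u = u₁ + u₂` with `u₁ = -Kᵀ x`. -/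
  control : ∀ t, 0 ≤ t → u t = -(S.K ⬝ᵥ x t) + u₂ t
  predictor_init : xhat 0 = S.x₀
  predictor : ∀ t, 0 ≤ t →
    HasDerivWithinAt xhat (S.Am *ᵥ xhat t - (θhat t ⬝ᵥ x t) • S.b + u₂ t • S.b) (Ici 0) t
  /-- `dθ̂/dt = Γ_c Proj(θ̂, x x̃ᵀ P b)`, `θ̂(0) = θ̂₀`, with `x̃ = x̂ - x`; the right-hand side is
  discontinuous in `θ̂`, so this holds in the sense of Carathéodory. -/
  adaptation : ∃ v : ℝ → Fin n → ℝ,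
    (∀ t, 0 ≤ t → IsProj S.Ω (θhat t) (((xhat t - x t) ⬝ᵥ (S.P *ᵥ S.b)) • x t) (v t)) ∧
    ∀ t, 0 ≤ t → IntervalIntegrable v volume 0 t ∧
      θhat t = S.θhat₀ + ∫ τ in (0 : ℝ)..t, S.Γc • v τ
  /-- `u₂(s) = C(s) (r̄(s) + k_g r(s))` with `r̄ = θ̂ᵀ x`. -/
  filtered : IsResponse S.C (fun t => θhat t ⬝ᵥ x t + S.kg * S.r t) u₂

/-- The closed-loop reference system: the plant with the controller
`u_ref(s) = C(s) (k_g r(s) + η(s)) - Kᵀ x_ref(s)`, `η = θᵀ x_ref`. -/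
structure IsReference (xref : ℝ → Fin n → ℝ) (uref : ℝ → ℝ) : Prop where
  plant : S.IsPlant xref uref
  control : IsResponse S.C (fun t => S.kg * S.r t + S.θ ⬝ᵥ xref t)
    (fun t => uref t + S.K ⬝ᵥ xref t)

end Setup

end L1Adaptive

end

/-!
The quantity `x̃ᵀ P x̃ + |θ̃|² / Γ_c`, with `x̃ = x̂ - x` and `θ̃ = θ̂ - θ`, does not increase along a
trajectory, because projecting onto the tangent cone of the convex set `Ω ∋ θ` only helps; it starts
with `x̃ = 0` and `|θ̃|² ≤ θ̄_max`, whence `|x̃_i| ≤ √(θ̄_max / λ_min(P)) / √Γ_c`.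

Stable proper transfer functions form a commutative ring that acts on causal signals, `d δ + h`
acting as `w ↦ d w + h ⋆ w`. Over this ring `x̃ = -H_o θ̃ᵀx` and `e = x - x_ref` satisfies
`e = Ḡ (θᵀ e) - C x̃`. The gain condition makes `1 - θᵀ Ḡ` invertible in the ring, by Wiener's lemma
for rational functions: its numerator has no zero with nonnegative real part. Solving the rank-one
equation gives `e = -H₂ x̃`, and cancelling `c_oᵀ H_o` gives
`u - u_ref = (C θᵀ - Kᵀ) e - C (c_oᵀ H_o)⁻¹ c_oᵀ x̃`. The bounds are the `L₁` gains of these systems.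
-/

noncomputable section

namespace L1Adaptive

open Filter Topology

/-! ### The Laplace transform on the half-line -/

/-- The Laplace transform `∫₀^∞ e^{-st} h(t) dt` of a function on `[0, ∞)`. -/
def laplace (h : ℝ → ℂ) (s : ℂ) : ℂ :=
  ∫ t in Ici (0 : ℝ), Complex.exp (-s * t) * h t

lemma norm_exp_neg_mul_le_one {s : ℂ} (hs : 0 ≤ s.re) {t : ℝ} (ht : 0 ≤ t) :
    ‖Complex.exp (-s * t)‖ ≤ 1 := by
  rw [Complex.norm_exp, Real.exp_le_one_iff, Complex.re_mul_ofReal, Complex.neg_re]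
  exact mul_nonpos_of_nonpos_of_nonneg (neg_nonpos.2 hs) ht

lemma norm_exp_neg_mul_mul_le {s : ℂ} (hs : 0 ≤ s.re) {t : ℝ} (ht : 0 ≤ t) (z : ℂ) :
    ‖Complex.exp (-s * t) * z‖ ≤ ‖z‖ := by
  rw [norm_mul]
  exact mul_le_of_le_one_left (norm_nonneg z) (norm_exp_neg_mul_le_one hs ht)

lemma integrableOn_exp_neg_mul {h : ℝ → ℂ} (hh : IntegrableOn h (Ici 0)) {s : ℂ}
    (hs : 0 ≤ s.re) : IntegrableOn (fun t : ℝ => Complex.exp (-s * t) * h t) (Ici 0) := by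
  have hexp : Continuous fun t : ℝ => Complex.exp (-s * t) := by fun_prop
  refine Integrable.mono hh (hexp.aestronglyMeasurable.mul hh.aestronglyMeasurable) ?_
  filter_upwards [ae_restrict_mem measurableSet_Ici] with t ht
  exact norm_exp_neg_mul_mul_le hs ht (h t)

lemma norm_laplace_le {h : ℝ → ℂ} (hh : IntegrableOn h (Ici 0)) {s : ℂ} (hs : 0 ≤ s.re) :
    ‖laplace h s‖ ≤ ∫ t in Ici (0 : ℝ), ‖h t‖ := by
  refine norm_integral_le_of_norm_le hh.norm ?_
  filter_upwards [ae_restrict_mem measurableSet_Ici] with t ht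
  exact norm_exp_neg_mul_mul_le hs ht (h t)

lemma laplace_add {f g : ℝ → ℂ} (hf : IntegrableOn f (Ici 0)) (hg : IntegrableOn g (Ici 0))
    {s : ℂ} (hs : 0 ≤ s.re) : laplace (f + g) s = laplace f s + laplace g s := by
  simp only [laplace, Pi.add_apply, mul_add]
  exact integral_add (integrableOn_exp_neg_mul hf hs) (integrableOn_exp_neg_mul hg hs)

lemma laplace_const_smul (a : ℂ) (h : ℝ → ℂ) (s : ℂ) :
    laplace (a • h) s = a * laplace h s := by
  simp only [laplace, ← integral_const_mul, Pi.smul_apply, smul_eq_mul, mul_left_comm]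

lemma laplace_conj (h : ℝ → ℂ) (s : ℂ) :
    laplace (fun t => starRingEnd ℂ (h t)) (starRingEnd ℂ s) = starRingEnd ℂ (laplace h s) := by
  simp only [laplace, ← integral_conj, map_mul, ← Complex.exp_conj, map_neg, Complex.conj_ofReal]

lemma tendsto_laplace_atTop {h : ℝ → ℂ} (hh : IntegrableOn h (Ici 0)) :
    Tendsto (fun x : ℝ => laplace h x) atTop (𝓝 0) := by
  have hlim : ∀ t : ℝ, 0 < t →
      Tendsto (fun x : ℝ => Complex.exp (-(x : ℂ) * t) * h t) atTop (𝓝 0) := fun t ht => by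
    have hexp : Tendsto (fun x : ℝ => Complex.exp ((-(x * t) : ℝ) : ℂ)) atTop (𝓝 0) := by
      simpa only [Complex.ofReal_exp, Complex.ofReal_zero, Function.comp_def, id_eq] using
        (Complex.continuous_ofReal.tendsto 0).comp
          (Real.tendsto_exp_neg_atTop_nhds_zero.comp (tendsto_id.atTop_mul_const ht))
    simpa using hexp.mul_const (h t)
  have hconv := tendsto_integral_filter_of_dominated_convergence
    (μ := volume.restrict (Ici (0 : ℝ))) (l := atTop)
    (F := fun (x : ℝ) (t : ℝ) => Complex.exp (-(x : ℂ) * t) * h t) (f := fun _ => 0)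
    (fun t => ‖h t‖) ?_ ?_ hh.norm ?_
  · simpa [laplace] using hconv
  · filter_upwards [eventually_ge_atTop 0] with x hx
    exact (integrableOn_exp_neg_mul hh (by simpa using hx)).aestronglyMeasurable
  · filter_upwards [eventually_ge_atTop 0] with x hx
    filter_upwards [ae_restrict_mem measurableSet_Ici] with t ht
    exact norm_exp_neg_mul_mul_le (by simpa using hx) ht (h t)
  · filter_upwards [ae_restrict_mem measurableSet_Ici,
      ae_restrict_of_ae (Measure.ae_ne volume (0 : ℝ))] with t ht ht0
    exact hlim t (lt_of_le_of_ne ht ht0.symm)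

lemma charFun_withDensity_ofReal {μ : Measure ℝ} {k : ℝ → ℝ} (hk : Integrable k μ) (ω : ℝ) :
    charFun (μ.withDensity fun t => ENNReal.ofReal (k t)) ω =
      ∫ t, max (k t) 0 • Complex.exp (ω * t * Complex.I) ∂μ := by
  rw [charFun_apply_real, integral_withDensity_eq_integral_toReal_smul₀
    hk.1.aemeasurable.ennreal_ofReal (ae_of_all _ fun _ => ENNReal.ofReal_lt_top)]
  simp only [ENNReal.toReal_ofReal']

-- The densities `k⁺` and `k⁻` define finite measures with the same characteristic function.
lemma ae_eq_zero_of_forall_integral_exp_eq_zero {μ : Measure ℝ} {k : ℝ → ℝ}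
    (hk : Integrable k μ)
    (hk0 : ∀ ω : ℝ, ∫ t, k t • Complex.exp (ω * t * Complex.I) ∂μ = 0) : k =ᵐ[μ] 0 := by
  have hneg : Integrable (fun t => -k t) μ := hk.neg
  have hfin : ∀ {f : ℝ → ℝ}, Integrable f μ → ∫⁻ t, ENNReal.ofReal (f t) ∂μ ≠ ∞ :=
    fun hf => hf.lintegral_lt_top.ne
  have : IsFiniteMeasure (μ.withDensity fun t => ENNReal.ofReal (k t)) :=
    isFiniteMeasure_withDensity (hfin hk)
  have : IsFiniteMeasure (μ.withDensity fun t => ENNReal.ofReal (-k t)) :=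
    isFiniteMeasure_withDensity (hfin hneg)
  have hint : ∀ {f : ℝ → ℝ}, Integrable f μ → ∀ ω : ℝ,
      Integrable (fun t => max (f t) 0 • Complex.exp (ω * t * Complex.I)) μ := fun hf ω => by
    refine hf.pos_part.smul_bdd 1
      (by fun_prop : Continuous fun t : ℝ => Complex.exp (ω * t * Complex.I)).aestronglyMeasurable
      (ae_of_all _ fun t => ?_)
    rw [← Complex.ofReal_mul, Complex.norm_exp_ofReal_mul_I]
  have hmeasure : μ.withDensity (fun t => ENNReal.ofReal (k t)) =
      μ.withDensity (fun t => ENNReal.ofReal (-k t)) := by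
    refine Measure.ext_of_charFun (funext fun ω => ?_)
    rw [charFun_withDensity_ofReal hk, charFun_withDensity_ofReal hneg, ← sub_eq_zero,
      ← integral_sub (hint hk ω) (hint hneg ω), ← hk0 ω]
    congr 1 with t
    rw [← sub_smul, max_zero_sub_max_neg_zero_eq_self]
  filter_upwards [(withDensity_eq_iff hk.1.aemeasurable.ennreal_ofReal
    hneg.1.aemeasurable.ennreal_ofReal (hfin hk)).1 hmeasure] with t ht
  rcases le_total 0 (k t) with h | h
  · rw [ENNReal.ofReal_of_nonpos (neg_nonpos.2 h), ENNReal.ofReal_eq_zero] at ht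
    exact le_antisymm ht h
  · rw [ENNReal.ofReal_of_nonpos h, eq_comm, ENNReal.ofReal_eq_zero] at ht
    exact le_antisymm h (neg_nonpos.1 ht)

/-! ### Convolution on the half-line -/

section Convolution

variable {𝕜 : Type*} [RCLike 𝕜] {f g w : ℝ → 𝕜}

/-- A signal is causal if it vanishes at negative times. -/
def IsCausal (w : ℝ → 𝕜) : Prop := ∀ t < 0, w t = 0

lemma isCausal_indicator (f : ℝ → 𝕜) : IsCausal ((Ici (0 : ℝ)).indicator f) :=
  fun _ ht => indicator_of_notMem (notMem_Ici.2 ht) f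

lemma IsCausal.indicator_eq (hw : IsCausal w) : (Ici (0 : ℝ)).indicator w = w :=
  indicator_eq_self.2 fun t ht => not_lt.1 fun h => ht (hw t h)

/-- Convolution of scalar functions on the real line. -/
abbrev conv (f g : ℝ → 𝕜) : ℝ → 𝕜 := convolution f g (ContinuousLinearMap.mul ℝ 𝕜) volume

lemma conv_apply (f g : ℝ → 𝕜) (t : ℝ) : conv f g t = ∫ τ, f τ * g (t - τ) := rfl

lemma IsCausal.conv (hf : IsCausal f) (hg : IsCausal g) : IsCausal (conv f g) := fun t ht => by
  refine integral_eq_zero_of_ae (ae_of_all _ fun τ => ?_)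
  rcases lt_or_ge τ 0 with hτ | hτ
  · simp [hf τ hτ]
  · simp [hg (t - τ) (by linarith)]

lemma conv_indicator_indicator (f g : ℝ → 𝕜) {t : ℝ} (ht : 0 ≤ t) :
    conv ((Ici 0).indicator f) ((Ici 0).indicator g) t =
      ∫ τ in (0 : ℝ)..t, f (t - τ) * g τ := by
  rw [conv, convolution_eq_swap, intervalIntegral.integral_of_le ht, ← integral_Icc_eq_integral_Ioc,
    ← integral_indicator measurableSet_Icc]
  congr 1 with τ
  by_cases h₁ : 0 ≤ τ <;> by_cases h₂ : τ ≤ t <;> simp [indicator, h₁, h₂]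

lemma IsCausal.conv_congr_right (hf : IsCausal f) {w' : ℝ → 𝕜} {t : ℝ}
    (h : ∀ τ ≤ t, w τ = w' τ) : L1Adaptive.conv f w t = L1Adaptive.conv f w' t := by
  rw [conv_apply, conv_apply]
  congr 1 with τ
  rcases lt_or_ge τ 0 with hτ | hτ
  · rw [hf τ hτ, zero_mul, zero_mul]
  · rw [h _ (by linarith)]

lemma convolutionExistsAt_of_isCausal (hf : Integrable f) (hfc : IsCausal f)
    (hw : AEStronglyMeasurable w) {t M : ℝ} (hM : ∀ τ ≤ t, ‖w τ‖ ≤ M) :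
    ConvolutionExistsAt f w t (ContinuousLinearMap.mul ℝ 𝕜) volume := by
  refine (hf.norm.mul_const M).mono'
    (hf.1.convolution_integrand_snd (ContinuousLinearMap.mul ℝ 𝕜) hw t) (ae_of_all _ fun τ => ?_)
  rw [ContinuousLinearMap.mul_apply', norm_mul]
  rcases lt_or_ge τ 0 with h | h
  · simp [hfc τ h]
  · exact mul_le_mul_of_nonneg_left (hM _ (by linarith)) (norm_nonneg _)

lemma convolutionExistsAt_of_bounded (hf : Integrable f) (hw : AEStronglyMeasurable w) {M : ℝ}
    (hM : ∀ τ, ‖w τ‖ ≤ M) (t : ℝ) :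
    ConvolutionExistsAt f w t (ContinuousLinearMap.mul ℝ 𝕜) volume := by
  refine (hf.norm.mul_const M).mono'
    (hf.1.convolution_integrand_snd (ContinuousLinearMap.mul ℝ 𝕜) hw t) (ae_of_all _ fun τ => ?_)
  rw [ContinuousLinearMap.mul_apply', norm_mul]
  exact mul_le_mul_of_nonneg_left (hM _) (norm_nonneg _)

lemma norm_conv_le (hf : Integrable f) {M : ℝ} (hM : ∀ τ, ‖w τ‖ ≤ M) (t : ℝ) :
    ‖conv f w t‖ ≤ (∫ τ, ‖f τ‖) * M := by
  rw [conv_apply, ← integral_mul_const]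
  refine norm_integral_le_of_norm_le (hf.norm.mul_const M) (ae_of_all _ fun τ => ?_)
  rw [norm_mul]
  exact mul_le_mul_of_nonneg_left (hM _) (norm_nonneg _)

lemma conv_assoc_of_bounded (hf : Integrable f) (hg : Integrable g) (hw : Integrable w) {M : ℝ}
    (hM : ∀ τ, ‖w τ‖ ≤ M) : conv (conv f g) w = conv f (conv g w) := by
  have hM' : ∀ τ, ‖‖w τ‖‖ ≤ M := by simpa only [norm_norm] using hM
  refine funext fun t => convolution_assoc _ _ _ _ (fun x y z => by simp [mul_assoc])
    hf.1 hg.1 hw.1 (hf.ae_convolution_exists _ hg)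
    (ae_of_all _ (convolutionExistsAt_of_bounded hg.norm hw.1.norm hM'))
    (convolutionExistsAt_of_bounded hf.norm
      (hg.norm.integrable_convolution (ContinuousLinearMap.mul ℝ ℝ) hw.norm).1
      (norm_conv_le hg.norm hM') t)

lemma integrableOn_conv_indicator (hf : IntegrableOn f (Ici 0))
    (hg : IntegrableOn g (Ici 0)) :
    IntegrableOn (conv ((Ici 0).indicator f) ((Ici 0).indicator g)) (Ici 0) :=
  ((hf.integrable_indicator measurableSet_Ici).integrable_convolution
    (ContinuousLinearMap.mul ℝ 𝕜) (hg.integrable_indicator measurableSet_Ici)).integrableOn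

end Convolution

lemma laplace_conv {f g : ℝ → ℂ} (hf : IntegrableOn f (Ici 0)) (hg : IntegrableOn g (Ici 0))
    {s : ℂ} (hs : 0 ≤ s.re) :
    laplace (conv ((Ici 0).indicator f) ((Ici 0).indicator g)) s = laplace f s * laplace g s := by
  have hprod := integral_posConvolution (μ := volume) (ν := volume)
    ((integrableOn_exp_neg_mul hg hs).mono_set Ioi_subset_Ici_self)
    ((integrableOn_exp_neg_mul hf hs).mono_set Ioi_subset_Ici_self)
    (ContinuousLinearMap.mul ℝ ℂ)
  simp only [ContinuousLinearMap.mul_apply', ← integral_Ici_eq_integral_Ioi] at hprod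
  rw [mul_comm]
  refine Eq.trans (setIntegral_congr_fun measurableSet_Ici fun t ht => ?_) hprod
  simp only [conv_indicator_indicator f g ht, ← intervalIntegral.integral_const_mul]
  congr 1 with τ
  have hexp : Complex.exp (-s * t) =
      Complex.exp (-s * τ) * Complex.exp (-s * ((t - τ : ℝ) : ℂ)) := by
    rw [← Complex.exp_add]
    push_cast
    ring_nf
  rw [hexp]
  ring

/-! ### Impulse responses -/

/-- The complex-valued analogue of `IsImpulseResponse`, used for partial fractions. -/
def IsComplexImpulseResponse (F : ℂ → ℂ) (d : ℂ) (h : ℝ → ℂ) : Prop :=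
  IntegrableOn h (Ici 0) ∧ ∀ s : ℂ, 0 ≤ s.re → F s = d + laplace h s

namespace IsComplexImpulseResponse

variable {F G : ℂ → ℂ} {d d' : ℂ} {h h' : ℝ → ℂ}

lemma congr (H : IsComplexImpulseResponse F d h) (hFG : ∀ s : ℂ, 0 ≤ s.re → G s = F s) :
    IsComplexImpulseResponse G d h :=
  ⟨H.1, fun s hs => (hFG s hs).trans (H.2 s hs)⟩

lemma add (H : IsComplexImpulseResponse F d h) (H' : IsComplexImpulseResponse G d' h') :
    IsComplexImpulseResponse (F + G) (d + d') (h + h') :=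
  ⟨H.1.add H'.1, fun s hs => by
    rw [laplace_add H.1 H'.1 hs, Pi.add_apply, H.2 s hs, H'.2 s hs, add_add_add_comm]⟩

lemma mul (H : IsComplexImpulseResponse F d h) (H' : IsComplexImpulseResponse G d' h') :
    IsComplexImpulseResponse (F * G) (d * d')
      (d • h' + d' • h + conv ((Ici 0).indicator h) ((Ici 0).indicator h')) := by
  have hconv := integrableOn_conv_indicator H.1 H'.1
  have hh' : IntegrableOn (d • h') (Ici 0) := H'.1.smul d
  have hh : IntegrableOn (d' • h) (Ici 0) := H.1.smul d'
  refine ⟨(hh'.add hh).add hconv, fun s hs => ?_⟩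
  rw [laplace_add (hh'.add hh) hconv hs, laplace_add hh' hh hs, laplace_const_smul,
    laplace_const_smul, laplace_conv H.1 H'.1 hs, Pi.mul_apply, H.2 s hs, H'.2 s hs]
  ring

lemma conj (H : IsComplexImpulseResponse F d h) :
    IsComplexImpulseResponse (fun s => starRingEnd ℂ (F (starRingEnd ℂ s))) (starRingEnd ℂ d)
      (fun t => starRingEnd ℂ (h t)) :=
  ⟨Integrable.mono H.1 (Complex.continuous_conj.comp_aestronglyMeasurable H.1.1)
      (ae_of_all _ fun t => by simp),
    fun s hs => by
      beta_reduce
      rw [H.2 _ (by simpa using hs), map_add, ← laplace_conj, Complex.conj_conj]⟩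

end IsComplexImpulseResponse

lemma isComplexImpulseResponse_const (a : ℂ) : IsComplexImpulseResponse (fun _ => a) a 0 :=
  ⟨integrableOn_zero, fun s _ => by simp [laplace]⟩

lemma isComplexImpulseResponse_inv_sub {z : ℂ} (hz : z.re < 0) :
    IsComplexImpulseResponse (fun s => (s - z)⁻¹) 0 (fun t => Complex.exp (z * t)) := by
  refine ⟨(integrableOn_Ici_iff_integrableOn_Ioi ..).2 (integrableOn_exp_mul_complex_Ioi hz 0),
    fun s hs => ?_⟩
  have hzs : (z - s).re < 0 := by rw [Complex.sub_re]; linarith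
  have hexp : ∀ t : ℝ, Complex.exp (-s * t) * Complex.exp (z * t) = Complex.exp ((z - s) * t) :=
    fun t => by rw [← Complex.exp_add]; ring_nf
  rw [zero_add, laplace, integral_Ici_eq_integral_Ioi]
  simp_rw [hexp]
  rw [integral_exp_mul_complex_Ioi hzs 0, Complex.ofReal_zero, mul_zero, Complex.exp_zero,
    neg_div, one_div, ← inv_neg, neg_sub]

lemma isImpulseResponse_iff_complex {F : ℂ → ℂ} {d : ℝ} {h : ℝ → ℝ} :
    IsImpulseResponse F d h ↔ IsComplexImpulseResponse F d (fun t => (h t : ℂ)) :=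
  and_congr_left' ⟨fun H => H.ofReal, fun H => by simpa [IntegrableOn] using H.re⟩

namespace IsImpulseResponse

variable {F G : ℂ → ℂ} {d d' : ℝ} {h h' : ℝ → ℝ}

lemma congr (H : IsImpulseResponse F d h) (hFG : ∀ s : ℂ, 0 ≤ s.re → G s = F s) :
    IsImpulseResponse G d h :=
  ⟨H.1, fun s hs => (hFG s hs).trans (H.2 s hs)⟩

lemma add (H : IsImpulseResponse F d h) (H' : IsImpulseResponse G d' h') :
    IsImpulseResponse (F + G) (d + d') (h + h') := by
  rw [isImpulseResponse_iff_complex] at *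
  convert H.add H' using 1
  · push_cast; rfl
  · ext t; simp

lemma mul (H : IsImpulseResponse F d h) (H' : IsImpulseResponse G d' h') :
    IsImpulseResponse (F * G) (d * d')
      (d • h' + d' • h + conv ((Ici 0).indicator h) ((Ici 0).indicator h')) := by
  rw [isImpulseResponse_iff_complex] at *
  convert H.mul H' using 1
  · push_cast; rfl
  · ext t
    have hconv : ((conv ((Ici 0).indicator h) ((Ici 0).indicator h') t : ℝ) : ℂ) =
        conv ((Ici 0).indicator fun t => (h t : ℂ)) ((Ici 0).indicator fun t => (h' t : ℂ)) t := by
      rw [conv_apply, conv_apply, ← integral_complex_ofReal]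
      congr 1 with τ
      by_cases h₁ : 0 ≤ τ <;> by_cases h₂ : τ ≤ t <;> simp [indicator, h₁, h₂]
    simp [hconv]

lemma tendsto_atTop (H : IsImpulseResponse F d h) :
    Tendsto (fun x : ℝ => F x) atTop (𝓝 d) := by
  have hlim := (tendsto_laplace_atTop (isImpulseResponse_iff_complex.1 H).1).const_add (d : ℂ)
  rw [add_zero] at hlim
  refine hlim.congr' ?_
  filter_upwards [eventually_ge_atTop 0] with x hx
  exact (H.2 x (by simpa using hx)).symm

lemma feedthrough_unique (H : IsImpulseResponse F d h) (H' : IsImpulseResponse F d' h') :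
    d = d' :=
  Complex.ofReal_injective (tendsto_nhds_unique H.tendsto_atTop H'.tendsto_atTop)

lemma kernel_unique (H : IsImpulseResponse F d h) (H' : IsImpulseResponse F d' h') :
    h =ᵐ[volume.restrict (Ici 0)] h' := by
  suffices h - h' =ᵐ[volume.restrict (Ici 0)] 0 by
    filter_upwards [this] with t ht using sub_eq_zero.1 ht
  refine ae_eq_zero_of_forall_integral_exp_eq_zero (H.1.sub H'.1) fun ω => ?_
  have hs : 0 ≤ (-(ω : ℂ) * Complex.I).re := by simp
  have hlaplace := (H.2 _ hs).symm.trans (H'.2 _ hs)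
  rw [H.feedthrough_unique H', add_right_inj, ← sub_eq_zero, ← integral_sub
    (integrableOn_exp_neg_mul (isImpulseResponse_iff_complex.1 H).1 hs)
    (integrableOn_exp_neg_mul (isImpulseResponse_iff_complex.1 H').1 hs)] at hlaplace
  rw [← hlaplace]
  congr 1 with t
  rw [Pi.sub_apply, Complex.real_smul, ← mul_sub, mul_comm, Complex.ofReal_sub]
  ring_nf

end IsImpulseResponse

lemma isImpulseResponse_const (a : ℝ) : IsImpulseResponse (fun _ => (a : ℂ)) a 0 :=
  ⟨integrableOn_zero, fun s _ => by simp⟩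

-- `(F + F*) / 2`, where `F*(s) = conj (F (conj s))`, has the real part of the impulse response.
lemma IsComplexImpulseResponse.re {F : ℂ → ℂ} {d : ℂ} {h : ℝ → ℂ}
    (H : IsComplexImpulseResponse F d h)
    (hF : ∀ s : ℂ, F (starRingEnd ℂ s) = starRingEnd ℂ (F s)) :
    IsImpulseResponse F d.re (fun t => (h t).re) := by
  have hsymm : (fun _ => (1 / 2 : ℂ)) * (F + fun s => starRingEnd ℂ (F (starRingEnd ℂ s))) = F := by
    ext s
    simp only [Pi.mul_apply, Pi.add_apply, hF, Complex.conj_conj]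
    ring
  have Hmean := (isComplexImpulseResponse_const (1 / 2)).mul (H.add H.conj)
  rw [hsymm] at Hmean
  rw [isImpulseResponse_iff_complex]
  convert Hmean using 1
  · rw [Complex.add_conj]
    push_cast
    ring
  · ext t
    suffices ((h t).re : ℂ) = 2⁻¹ * (h t + starRingEnd ℂ (h t)) by simpa [mul_add]
    rw [Complex.add_conj]
    push_cast
    ring

/-! ### Causal signals as a module over the stable systems -/

/-- The causal real signals that are continuous on `[0, ∞)`. -/
def causalSignals : Submodule ℝ (ℝ → ℝ) where
  carrier := {w | ContinuousOn w (Ici 0) ∧ IsCausal w}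
  add_mem' := fun ha hb => ⟨ha.1.add hb.1, fun t ht => by simp [ha.2 t ht, hb.2 t ht]⟩
  zero_mem' := ⟨continuousOn_const, fun _ _ => rfl⟩
  smul_mem' := fun c _ ha => ⟨ha.1.const_smul c, fun t ht => by simp [ha.2 t ht]⟩

/-- The type of causal real signals that are continuous on `[0, ∞)`. -/
abbrev Sig : Type := causalSignals

namespace Sig

instance : CoeFun Sig fun _ => ℝ → ℝ := ⟨Subtype.val⟩

variable (v w : Sig)

lemma continuousOn : ContinuousOn w (Ici 0) := w.2.1

lemma isCausal : IsCausal w := w.2.2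

/-- The causal signal that agrees with a given function on `[0, ∞)`. -/
def of (f : ℝ → ℝ) (hf : ContinuousOn f (Ici 0)) : Sig :=
  ⟨(Ici 0).indicator f, hf.congr fun _ ht => indicator_of_mem ht f, isCausal_indicator f⟩

lemma of_apply {f : ℝ → ℝ} (hf : ContinuousOn f (Ici 0)) {t : ℝ} (ht : 0 ≤ t) :
    of f hf t = f t := indicator_of_mem (mem_Ici.2 ht) f

variable {v w} in
lemma ext_nonneg (h : ∀ t, 0 ≤ t → v t = w t) : v = w := by
  refine Subtype.ext (funext fun t => ?_)
  rcases lt_or_ge t 0 with ht | ht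
  · rw [v.isCausal t ht, w.isCausal t ht]
  · exact h t ht

@[simp] lemma add_apply (t : ℝ) : (v + w) t = v t + w t := rfl

@[simp] lemma sub_apply (t : ℝ) : (v - w) t = v t - w t := rfl

@[simp] lemma neg_apply (t : ℝ) : (-v) t = -v t := rfl

@[simp] lemma smul_apply (a : ℝ) (t : ℝ) : (a • w) t = a * w t := rfl

lemma sum_apply {ι : Type*} (s : Finset ι) (v : ι → Sig) (t : ℝ) :
    (∑ i ∈ s, v i) t = ∑ i ∈ s, v i t := by
  rw [AddSubmonoidClass.coe_finsetSum, Finset.sum_apply]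

lemma exists_bound (T : ℝ) : ∃ M : ℝ, ∀ t ≤ T, ‖w t‖ ≤ M := by
  obtain ⟨M, hM⟩ := (isCompact_Icc (a := (0 : ℝ)) (b := T)).exists_bound_of_continuousOn
    (w.continuousOn.mono Icc_subset_Ici_self)
  refine ⟨max M 0, fun t ht => ?_⟩
  rcases lt_or_ge t 0 with h | h
  · simp [w.isCausal t h]
  · exact (hM t ⟨h, ht⟩).trans (le_max_left _ _)

lemma aestronglyMeasurable : AEStronglyMeasurable w := by
  rw [← w.isCausal.indicator_eq, aestronglyMeasurable_indicator_iff measurableSet_Ici]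
  exact w.continuousOn.aestronglyMeasurable measurableSet_Ici

lemma continuousAt_of_ne_zero {t : ℝ} (ht : t ≠ 0) : ContinuousAt w t := by
  rcases lt_or_gt_of_ne ht with h | h
  · refine continuousAt_const.congr (f := fun _ => 0) ?_
    filter_upwards [Iio_mem_nhds h] with σ hσ using (w.isCausal σ hσ).symm
  · exact w.continuousOn.continuousAt (Ici_mem_nhds h)

variable {f g : ℝ → ℝ}

lemma convolutionExistsAt (hf : Integrable f) (hfc : IsCausal f) (t : ℝ) :
    ConvolutionExistsAt f w t (ContinuousLinearMap.mul ℝ ℝ) volume :=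
  convolutionExistsAt_of_isCausal hf hfc w.aestronglyMeasurable (w.exists_bound t).choose_spec

lemma continuous_conv (hf : Integrable f) (hfc : IsCausal f) : Continuous (conv f w) := by
  refine continuous_iff_continuousAt.2 fun t₀ => ?_
  obtain ⟨M, hM⟩ := w.exists_bound (t₀ + 1)
  refine continuousAt_of_dominated (bound := fun τ => ‖f τ‖ * M)
    (Eventually.of_forall fun t => (w.convolutionExistsAt hf hfc t).1) ?_ (hf.norm.mul_const M) ?_
  · filter_upwards [Iic_mem_nhds (lt_add_one t₀)] with t ht
    refine ae_of_all _ fun τ => ?_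
    rw [ContinuousLinearMap.mul_apply', norm_mul]
    rcases lt_or_ge τ 0 with h | h
    · simp [hfc τ h]
    · exact mul_le_mul_of_nonneg_left (hM _ (by linarith [mem_Iic.1 ht])) (norm_nonneg _)
  · filter_upwards [Measure.ae_ne volume t₀] with τ hτ
    exact continuousAt_const.mul (ContinuousAt.comp (f := fun t => t - τ)
      (w.continuousAt_of_ne_zero (sub_ne_zero.2 hτ.symm)) (by fun_prop))

-- Truncating `w` after `t` does not change the values at `t`, and makes `w` integrable.
lemma conv_assoc (hf : Integrable f) (hfc : IsCausal f) (hg : Integrable g) (hgc : IsCausal g) :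
    conv (conv f g) w = conv f (conv g w) := by
  ext t
  obtain ⟨M, hM⟩ := w.exists_bound t
  have htrunc : ∀ τ ≤ t, w τ = (Icc 0 t).indicator w τ := fun τ hτ => by
    by_cases h : 0 ≤ τ
    · rw [indicator_of_mem (mem_Icc.2 ⟨h, hτ⟩)]
    · rw [indicator_of_notMem fun h' => h h'.1, w.isCausal τ (not_le.1 h)]
  have hint : Integrable ((Icc 0 t).indicator w) :=
    ((w.continuousOn.mono Icc_subset_Ici_self).integrableOn_Icc).integrable_indicator
      measurableSet_Icc
  have hbound : ∀ τ, ‖(Icc 0 t).indicator w τ‖ ≤ max M 0 := fun τ => by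
    by_cases h : τ ∈ Icc 0 t
    · rw [indicator_of_mem h]
      exact (hM τ h.2).trans (le_max_left _ _)
    · simp [indicator_of_notMem h]
  rw [(hfc.conv hgc).conv_congr_right htrunc, conv_assoc_of_bounded hf hg hint hbound]
  exact hfc.conv_congr_right fun τ hτ =>
    (hgc.conv_congr_right fun σ hσ => htrunc σ (hσ.trans hτ)).symm

/-- Convolution with the integrable kernel `h` on `[0, ∞)`, as an operator on causal signals. -/
def kernelOp (h : ℝ → ℝ) (hh : IntegrableOn h (Ici 0)) : Module.End ℝ Sig where
  toFun w := ⟨conv ((Ici 0).indicator h) w,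
    (w.continuous_conv (hh.integrable_indicator measurableSet_Ici)
      (isCausal_indicator h)).continuousOn, (isCausal_indicator h).conv w.isCausal⟩
  map_add' v w := Subtype.ext <| funext fun t =>
    (v.convolutionExistsAt (hh.integrable_indicator measurableSet_Ici)
      (isCausal_indicator h) t).distrib_add
      (w.convolutionExistsAt (hh.integrable_indicator measurableSet_Ici) (isCausal_indicator h) t)
  map_smul' _ _ := Subtype.ext convolution_smul

lemma kernelOp_apply {h : ℝ → ℝ} (hh : IntegrableOn h (Ici 0)) (t : ℝ) :
    kernelOp h hh w t = conv ((Ici 0).indicator h) w t := rfl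

section kernelOp

variable {h h' : ℝ → ℝ} (hh : IntegrableOn h (Ici 0)) (hh' : IntegrableOn h' (Ici 0))

variable {hh hh'} in
lemma kernelOp_congr (H : h =ᵐ[volume.restrict (Ici 0)] h') : kernelOp h hh = kernelOp h' hh' :=
  LinearMap.ext fun w => Subtype.ext <| convolution_congr _
    ((ae_eq_restrict_iff_indicator_ae_eq measurableSet_Ici).1 H) (ae_eq_refl w.1)

lemma kernelOp_zero : kernelOp 0 integrableOn_zero = 0 := by
  refine LinearMap.ext fun w => Subtype.ext (funext fun t => ?_)
  simp [kernelOp_apply, conv_apply]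

lemma kernelOp_add : kernelOp (h + h') (hh.add hh') = kernelOp h hh + kernelOp h' hh' := by
  refine LinearMap.ext fun w => Subtype.ext (funext fun t => ?_)
  rw [kernelOp_apply, indicator_add']
  exact (w.convolutionExistsAt (hh.integrable_indicator measurableSet_Ici)
    (isCausal_indicator h) t).add_distrib
    (w.convolutionExistsAt (hh'.integrable_indicator measurableSet_Ici) (isCausal_indicator h') t)

lemma kernelOp_smul {a : ℝ} (H : IntegrableOn (a • h) (Ici 0)) :
    kernelOp (a • h) H = a • kernelOp h hh := by
  refine LinearMap.ext fun w => Subtype.ext (funext fun t => ?_)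
  rw [kernelOp_apply, show (Ici 0).indicator (a • h) = a • (Ici (0 : ℝ)).indicator h from
    indicator_const_smul _ a h]
  exact congrFun smul_convolution t

lemma kernelOp_conv (H : IntegrableOn (conv ((Ici 0).indicator h) ((Ici 0).indicator h')) (Ici 0)) :
    kernelOp _ H = kernelOp h hh * kernelOp h' hh' := by
  refine LinearMap.ext fun w => Subtype.ext (funext fun t => ?_)
  rw [kernelOp_apply, ((isCausal_indicator h).conv (isCausal_indicator h')).indicator_eq,
    w.conv_assoc (hh.integrable_indicator measurableSet_Ici) (isCausal_indicator h)
      (hh'.integrable_indicator measurableSet_Ici) (isCausal_indicator h')]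
  rfl

end kernelOp

end Sig

namespace IsImpulseResponse

variable {F G : ℂ → ℂ} {d d' : ℝ} {h h' : ℝ → ℝ}

/-- The response operator `w ↦ d w + h ∗ w` of a system with impulse response `d δ + h`. -/
def respond (H : IsImpulseResponse F d h) : Module.End ℝ Sig := d • 1 + Sig.kernelOp h H.1

lemma respond_apply (H : IsImpulseResponse F d h) (w : Sig) (t : ℝ) :
    H.respond w t = d * w t + conv ((Ici 0).indicator h) w t := rfl

lemma respond_eq (H : IsImpulseResponse F d h) (H' : IsImpulseResponse F d' h') :
    H.respond = H'.respond := by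
  exact congrArg₂ (· • 1 + ·) (H.feedthrough_unique H') (Sig.kernelOp_congr (H.kernel_unique H'))

lemma respond_const (a : ℝ) : (isImpulseResponse_const a).respond = a • 1 := by
  rw [respond, Sig.kernelOp_zero, add_zero]

lemma respond_add (H : IsImpulseResponse F d h) (H' : IsImpulseResponse G d' h') :
    (H.add H').respond = H.respond + H'.respond := by
  rw [respond, respond, respond, Sig.kernelOp_add H.1 H'.1, add_smul, add_add_add_comm]

lemma respond_mul (H : IsImpulseResponse F d h) (H' : IsImpulseResponse G d' h') :
    (H.mul H').respond = H.respond * H'.respond := by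
  have hh : IntegrableOn (d' • h) (Ici 0) := H.1.smul d'
  have hh' : IntegrableOn (d • h') (Ici 0) := H'.1.smul d
  rw [respond, Sig.kernelOp_add (hh'.add hh) (integrableOn_conv_indicator H.1 H'.1),
    Sig.kernelOp_add hh' hh, Sig.kernelOp_smul H'.1 hh', Sig.kernelOp_smul H.1 hh,
    Sig.kernelOp_conv H.1 H'.1]
  simp only [respond, mul_add, add_mul, mul_one, one_mul, smul_mul_assoc, mul_smul_comm,
    smul_add, mul_smul, smul_comm d d']
  abel

end IsImpulseResponse

/-- The closed right half-plane. -/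
abbrev RHP : Type := {s : ℂ // 0 ≤ s.re}

/-- The stable proper transfer functions, restricted to the closed right half-plane. -/
def stableSubring : Subring (RHP → ℂ) where
  carrier := {F | ∃ G : ℂ → ℂ, (∀ s : RHP, F s = G s) ∧ ∃ d h, IsImpulseResponse G d h}
  mul_mem' := by
    rintro F F' ⟨G, hG, d, h, H⟩ ⟨G', hG', d', h', H'⟩
    exact ⟨_, fun s => by simp only [Pi.mul_apply, hG, hG'], _, _, H.mul H'⟩
  add_mem' := by
    rintro F F' ⟨G, hG, d, h, H⟩ ⟨G', hG', d', h', H'⟩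
    exact ⟨_, fun s => by simp only [Pi.add_apply, hG, hG'], _, _, H.add H'⟩
  one_mem' := ⟨_, fun s => by simp, _, _, isImpulseResponse_const 1⟩
  zero_mem' := ⟨_, fun s => by simp, _, _, isImpulseResponse_const 0⟩
  neg_mem' := by
    rintro F ⟨G, hG, d, h, H⟩
    exact ⟨_, fun s => by simp [hG], _, _, (isImpulseResponse_const (-1)).mul H⟩

/-- The commutative ring of stable proper systems. -/
abbrev StableSys : Type := stableSubring

namespace StableSys

/-- `F.Realizes G`: the stable system `F` has the transfer function `G` on the closed right
half-plane. The values of `G` elsewhere are irrelevant. -/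
def Realizes (F : StableSys) (G : ℂ → ℂ) : Prop := ∀ s : RHP, F.1 s = G s

/-- The stable system with a given transfer function. -/
def mk (G : ℂ → ℂ) (hG : ∃ d h, IsImpulseResponse G d h) : StableSys :=
  ⟨fun s => G s, G, fun _ => rfl, hG⟩

lemma realizes_mk {G : ℂ → ℂ} (hG : ∃ d h, IsImpulseResponse G d h) : (mk G hG).Realizes G :=
  fun _ => rfl

lemma exists_realizes (F : StableSys) :
    ∃ (G : ℂ → ℂ) (d : ℝ) (h : ℝ → ℝ), F.Realizes G ∧ IsImpulseResponse G d h :=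
  let ⟨G, hG, d, h, H⟩ := F.2
  ⟨G, d, h, hG, H⟩

lemma Realizes.eq {F : StableSys} {G G' : ℂ → ℂ} (hG : F.Realizes G) (hG' : F.Realizes G')
    {s : ℂ} (hs : 0 ≤ s.re) : G s = G' s :=
  (hG ⟨s, hs⟩).symm.trans (hG' ⟨s, hs⟩)

lemma Realizes.exists_isImpulseResponse {F : StableSys} {G : ℂ → ℂ} (hF : F.Realizes G) :
    ∃ d h, IsImpulseResponse G d h :=
  let ⟨_, d, h, hG', H⟩ := F.exists_realizes
  ⟨d, h, H.congr fun _ => hF.eq hG'⟩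

/-- Evaluation of stable systems at a point of the closed right half-plane. -/
def evalHom (s : RHP) : StableSys →+* ℂ := (Pi.evalRingHom _ s).comp stableSubring.subtype

lemma Realizes.evalHom_eq {F : StableSys} {G : ℂ → ℂ} (hF : F.Realizes G) (s : RHP) :
    evalHom s F = G s := hF s

lemma ext_evalHom {F F' : StableSys} (h : ∀ s, evalHom s F = evalHom s F') : F = F' :=
  Subtype.ext (funext h)

/-- The response operator of a stable system. -/
def respond (F : StableSys) : Module.End ℝ Sig :=
  F.exists_realizes.choose_spec.choose_spec.choose_spec.2.respond

lemma Realizes.respond_eq {F : StableSys} {G : ℂ → ℂ} (hF : F.Realizes G) {d : ℝ} {h : ℝ → ℝ}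
    (H : IsImpulseResponse G d h) : F.respond = H.respond :=
  have hF' := F.exists_realizes.choose_spec.choose_spec.choose_spec.1
  IsImpulseResponse.respond_eq _ (H.congr fun _ => hF'.eq hF)

lemma respond_mk {G : ℂ → ℂ} {d : ℝ} {h : ℝ → ℝ} (H : IsImpulseResponse G d h) :
    (mk G ⟨d, h, H⟩).respond = H.respond :=
  (realizes_mk _).respond_eq H

/-- The constant system `a`. -/
def const (a : ℝ) : StableSys := mk (fun _ => (a : ℂ)) ⟨_, _, isImpulseResponse_const a⟩

lemma respond_const (a : ℝ) : (const a).respond = a • 1 :=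
  (respond_mk _).trans (IsImpulseResponse.respond_const a)

lemma realizes_const (a : ℝ) : (const a).Realizes fun _ => (a : ℂ) := realizes_mk _

lemma const_one : const 1 = 1 := Subtype.ext (funext fun _ => Complex.ofReal_one)

lemma const_zero : const 0 = 0 := Subtype.ext (funext fun _ => Complex.ofReal_zero)

/-- The representation of the ring of stable systems on the causal signals. -/
def respondHom : StableSys →+* Module.End ℝ Sig where
  toFun := respond
  map_one' := by rw [← const_one, respond_const, one_smul]
  map_zero' := by rw [← const_zero, respond_const, zero_smul]
  map_mul' F F' := by
    obtain ⟨G, d, h, hG, H⟩ := F.exists_realizes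
    obtain ⟨G', d', h', hG', H'⟩ := F'.exists_realizes
    have hmul : (F * F').Realizes (G * G') := fun s => congrArg₂ (· * ·) (hG s) (hG' s)
    rw [hmul.respond_eq (H.mul H'), hG.respond_eq H, hG'.respond_eq H', H.respond_mul H']
  map_add' F F' := by
    obtain ⟨G, d, h, hG, H⟩ := F.exists_realizes
    obtain ⟨G', d', h', hG', H'⟩ := F'.exists_realizes
    have hadd : (F + F').Realizes (G + G') := fun s => congrArg₂ (· + ·) (hG s) (hG' s)
    rw [hadd.respond_eq (H.add H'), hG.respond_eq H, hG'.respond_eq H', H.respond_add H']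

instance : Module StableSys Sig := Module.compHom Sig respondHom

lemma Realizes.smul_apply {F : StableSys} {G : ℂ → ℂ} (hF : F.Realizes G) {d : ℝ} {h : ℝ → ℝ}
    (H : IsImpulseResponse G d h) (w : Sig) (t : ℝ) :
    (F • w) t = d * w t + conv ((Ici 0).indicator h) w t := by
  rw [← H.respond_apply, ← hF.respond_eq H]
  rfl

lemma const_smul (a : ℝ) (w : Sig) : const a • w = a • w :=
  LinearMap.congr_fun (respond_const a) w

end StableSys

lemma IsResponse.eq_smul {G : ℂ → ℂ} {w v : ℝ → ℝ} (H : IsResponse G w v) {F : StableSys}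
    (hF : F.Realizes G) {w' : Sig} (hw : ∀ t, 0 ≤ t → w' t = w t) {t : ℝ} (ht : 0 ≤ t) :
    v t = (F • w') t := by
  obtain ⟨d, h, H, hv⟩ := H
  rw [hF.smul_apply H, ← w'.isCausal.indicator_eq, conv_indicator_indicator h _ ht, hv t ht,
    w'.isCausal.indicator_eq, hw t ht]
  congr 1
  refine intervalIntegral.integral_congr fun τ hτ => ?_
  rw [uIcc_of_le ht] at hτ
  simp only [hw τ hτ.1]

/-! ### `L₁` gains -/

section Gain

variable {G : ℂ → ℂ} {d : ℝ} {h : ℝ → ℝ}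

lemma IsImpulseResponse.sisoL1Gain_eq (H : IsImpulseResponse G d h) :
    sisoL1Gain G = ENNReal.ofReal |d| + ∫⁻ t in Ici (0 : ℝ), ENNReal.ofReal |h t| := by
  refine le_antisymm (iInf_le_of_le d (iInf_le_of_le h (iInf_le _ H)))
    (le_iInf fun d' => le_iInf fun h' => le_iInf fun H' => ?_)
  rw [H.feedthrough_unique H']
  gcongr 1
  refine (lintegral_congr_ae ?_).le
  filter_upwards [H.kernel_unique H'] with t ht
  rw [ht]

lemma IsImpulseResponse.sisoL1Gain_eq_ofReal (H : IsImpulseResponse G d h) :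
    sisoL1Gain G = ENNReal.ofReal (|d| + ∫ t in Ici (0 : ℝ), |h t|) := by
  rw [H.sisoL1Gain_eq, ENNReal.ofReal_add (abs_nonneg _) (integral_nonneg fun _ => abs_nonneg _),
    ofReal_integral_eq_lintegral_ofReal H.1.abs (ae_of_all _ fun _ => abs_nonneg _)]

lemma sisoL1Gain_lt_top (hG : ∃ d h, IsImpulseResponse G d h) : sisoL1Gain G < ∞ := by
  obtain ⟨d, h, H⟩ := hG
  rw [H.sisoL1Gain_eq_ofReal]
  exact ENNReal.ofReal_lt_top

lemma ofReal_norm_le_sisoL1Gain {s : ℂ} (hs : 0 ≤ s.re) :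
    ENNReal.ofReal ‖G s‖ ≤ sisoL1Gain G := by
  refine le_iInf fun d => le_iInf fun h => le_iInf fun H => ?_
  rw [← H.sisoL1Gain_eq, H.sisoL1Gain_eq_ofReal]
  have hlaplace := norm_laplace_le (isImpulseResponse_iff_complex.1 H).1 hs
  simp only [Complex.norm_real, Real.norm_eq_abs] at hlaplace
  rw [H.2 s hs]
  exact ENNReal.ofReal_le_ofReal ((norm_add_le _ _).trans (add_le_add (by simp) hlaplace))

lemma StableSys.Realizes.abs_smul_le {F : StableSys} (hF : F.Realizes G)
    (H : IsImpulseResponse G d h) {w : Sig} {M : ℝ} (hM : ∀ t, 0 ≤ t → |w t| ≤ M) (t : ℝ) :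
    |(F • w) t| ≤ (|d| + ∫ t in Ici (0 : ℝ), |h t|) * M := by
  have hM' : ∀ t, ‖w t‖ ≤ M := fun t => by
    rcases lt_or_ge t 0 with ht | ht
    · rw [w.isCausal t ht, norm_zero]
      exact (abs_nonneg _).trans (hM 0 le_rfl)
    · exact hM t ht
  rw [hF.smul_apply H, add_mul]
  refine (abs_add_le _ _).trans (add_le_add ?_ ?_)
  · rw [abs_mul]
    exact mul_le_mul_of_nonneg_left (hM' t) (abs_nonneg _)
  · refine (norm_conv_le (H.1.integrable_indicator measurableSet_Ici) hM' t).trans_eq ?_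
    simp only [norm_indicator_eq_indicator_norm, integral_indicator measurableSet_Ici,
      Real.norm_eq_abs]

lemma StableSys.Realizes.ofReal_abs_smul_le {F : StableSys} (hF : F.Realizes G) {w : Sig} {M : ℝ}
    (hM : ∀ t, 0 ≤ t → |w t| ≤ M) (t : ℝ) :
    ENNReal.ofReal |(F • w) t| ≤ sisoL1Gain G * ENNReal.ofReal M := by
  obtain ⟨d, h, H⟩ := hF.exists_isImpulseResponse
  rw [H.sisoL1Gain_eq_ofReal, ← ENNReal.ofReal_mul (by positivity)]
  exact ENNReal.ofReal_le_ofReal (hF.abs_smul_le H hM t)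

end Gain

/-! ### Rational transfer functions -/

section Rational

open Polynomial

-- A root `z` of the denominator is split off by dividing the numerator by `X - z` with remainder.
lemma exists_isComplexImpulseResponse_div (n : ℕ) : ∀ p q : ℂ[X], q.natDegree = n → q ≠ 0 →
    (∀ z, q.IsRoot z → z.re < 0) → p.natDegree ≤ n →
    ∃ d h, IsComplexImpulseResponse (fun s => p.eval s / q.eval s) d h := by
  induction n with
  | zero =>
    intro p q hq _ _ hp
    rw [eq_C_of_natDegree_eq_zero hq, eq_C_of_natDegree_le_zero hp]
    simp only [eval_C]
    exact ⟨_, _, isComplexImpulseResponse_const _⟩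
  | succ n ih =>
    intro p q hq hq0 hroot hp
    obtain ⟨z, hz⟩ := IsAlgClosed.exists_root q fun h => by
      rw [natDegree_eq_of_degree_eq_some h] at hq
      exact (Nat.succ_ne_zero n).symm hq
    obtain ⟨q₂, rfl⟩ := dvd_iff_isRoot.2 hz
    have hq₂ : q₂ ≠ 0 := right_ne_zero_of_mul hq0
    have hq₂n : q₂.natDegree = n := by
      rw [natDegree_mul (X_sub_C_ne_zero z) hq₂, natDegree_X_sub_C] at hq
      omega
    have hq₂root : ∀ w, q₂.IsRoot w → w.re < 0 := fun w hw =>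
      hroot w (by rw [IsRoot.def, eval_mul, hw.eq_zero, mul_zero])
    obtain ⟨_, _, H₁⟩ := ih (p /ₘ (X - C z)) q₂ hq₂n hq₂ hq₂root (by
      rw [natDegree_divByMonic p (monic_X_sub_C z), natDegree_X_sub_C]
      omega)
    obtain ⟨_, _, H₂⟩ := ih (C (p.eval z)) q₂ hq₂n hq₂ hq₂root (by simp)
    refine ⟨_, _, (H₁.add (H₂.mul (isComplexImpulseResponse_inv_sub (hroot z hz)))).congr
      fun s hs => ?_⟩
    have hsz : s - z ≠ 0 := sub_ne_zero.2 fun h => (hroot z hz).not_ge (h ▸ hs)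
    have hq₂s : q₂.eval s ≠ 0 := fun h => (hq₂root s h).not_ge hs
    have hdiv : p.eval s = p.eval z + (s - z) * (p /ₘ (X - C z)).eval s := by
      conv_lhs => rw [← modByMonic_add_div p (X - C z), modByMonic_X_sub_C_eq_C_eval]
      simp only [eval_add, eval_mul, eval_sub, eval_C, eval_X]
    simp only [Pi.add_apply, Pi.mul_apply, eval_C, eval_mul, eval_sub, eval_X, hdiv]
    field_simp
    ring

variable {p q : ℝ[X]}

lemma IsStablePoly.ne_zero (hq : IsStablePoly q) : q ≠ 0 := by
  rintro rfl
  simpa using hq 0 (by simp)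

lemma IsStablePoly.aeval_ne_zero (hq : IsStablePoly q) {s : ℂ} (hs : 0 ≤ s.re) : aeval s q ≠ 0 :=
  fun h => (hq s h).not_ge hs

lemma IsStablePoly.mul (hp : IsStablePoly p) (hq : IsStablePoly q) : IsStablePoly (p * q) :=
  fun z hz => by
    rw [map_mul, mul_eq_zero] at hz
    exact hz.elim (hp z) (hq z)

lemma exists_isImpulseResponse_div (hq : IsStablePoly q) (hpq : p.natDegree ≤ q.natDegree) :
    ∃ d h, IsImpulseResponse (fun s => aeval s p / aeval s q) d h := by
  obtain ⟨d, h, H⟩ := exists_isComplexImpulseResponse_div (q.map (algebraMap ℝ ℂ)).natDegree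
    (p.map (algebraMap ℝ ℂ)) (q.map (algebraMap ℝ ℂ)) rfl
    (by simpa [Polynomial.map_eq_zero] using hq.ne_zero)
    (fun z hz => hq z (by rwa [IsRoot.def, eval_map_algebraMap] at hz))
    (by simpa using hpq)
  simp only [eval_map_algebraMap] at H
  exact ⟨_, _, H.re fun s => by rw [map_div₀, aeval_conj, aeval_conj]⟩

end Rational

/-! ### Linear systems with a Hurwitz matrix -/

lemma isImpulseResponse_lag :
    IsImpulseResponse (fun s => (s + 1)⁻¹) 0 (fun t => Real.exp (-t)) := by
  rw [isImpulseResponse_iff_complex]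
  simpa using isComplexImpulseResponse_inv_sub (z := -1) (by simp)

/-- The first-order lag `1 / (s + 1)`, which inverts `d/dt + 1` on signals vanishing at `0`. -/
def lag : StableSys := StableSys.mk (fun s => (s + 1)⁻¹) ⟨_, _, isImpulseResponse_lag⟩

lemma realizes_lag : lag.Realizes fun s => (s + 1)⁻¹ := StableSys.realizes_mk _

lemma eq_lag_smul {z g : Sig} (hz0 : z 0 = 0)
    (hz : ∀ t, 0 ≤ t → HasDerivWithinAt z (g t) (Ici 0) t) : z = lag • (z + g) := by
  have hexp (t τ : ℝ) : HasDerivAt (fun τ => Real.exp (-(t - τ))) (Real.exp (-(t - τ))) τ := by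
    simpa using (((hasDerivAt_id τ).const_sub t).neg).exp
  refine Sig.ext_nonneg fun t ht => ?_
  have hexpc : ContinuousOn (fun τ => Real.exp (-(t - τ))) (Icc 0 t) := by fun_prop
  have hc (w : Sig) : ContinuousOn w (Icc 0 t) := w.continuousOn.mono Icc_subset_Ici_self
  have key := intervalIntegral.integral_eq_sub_of_hasDeriv_right_of_le
    (f := fun τ => Real.exp (-(t - τ)) * z τ)
    (f' := fun τ => Real.exp (-(t - τ)) * (z + g) τ) ht (hexpc.mul (hc z))
    (fun τ hτ => ((hexp t τ).hasDerivWithinAt.mul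
      ((hz τ hτ.1.le).mono (Ioi_subset_Ici hτ.1.le))).congr_deriv (by
        rw [Sig.add_apply]
        ring))
    ((hexpc.mul (hc (z + g))).intervalIntegrable_of_Icc ht)
  rw [realizes_lag.smul_apply isImpulseResponse_lag, ← (z + g).isCausal.indicator_eq,
    conv_indicator_indicator _ _ ht, (z + g).isCausal.indicator_eq, key]
  simp [hz0]

section Resolvent

variable {n : ℕ} {A : Matrix (Fin n) (Fin n) ℝ}

variable (A) in
/-- The resolvent `(s I - A)⁻¹`. -/
def resolventMatrix (s : ℂ) : Matrix (Fin n) (Fin n) ℂ :=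
  (s • (1 : Matrix (Fin n) (Fin n) ℂ) - A.map (algebraMap ℝ ℂ))⁻¹

variable (A) in
lemma charmatrix_map_aeval (s : ℂ) :
    A.charmatrix.map (Polynomial.aeval s : Polynomial ℝ →ₐ[ℝ] ℂ) =
      s • (1 : Matrix (Fin n) (Fin n) ℂ) - A.map (algebraMap ℝ ℂ) := by
  ext i j
  simp only [Matrix.map_apply, Matrix.charmatrix_apply, Matrix.diagonal_apply, Matrix.sub_apply,
    Matrix.smul_apply, Matrix.one_apply, map_sub, Polynomial.aeval_C, smul_eq_mul]
  split_ifs <;> simp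

variable (A) in
lemma det_smul_one_sub (s : ℂ) :
    (s • (1 : Matrix (Fin n) (Fin n) ℂ) - A.map (algebraMap ℝ ℂ)).det =
      Polynomial.aeval s A.charpoly := by
  rw [← charmatrix_map_aeval, Matrix.charpoly, AlgHom.map_det, AlgHom.mapMatrix_apply]

variable (A) in
lemma resolventMatrix_apply (s : ℂ) (i j : Fin n) :
    resolventMatrix A s i j =
      Polynomial.aeval s (A.charmatrix.adjugate i j) / Polynomial.aeval s A.charpoly := by
  have hadj := AlgHom.map_adjugate (Polynomial.aeval s : Polynomial ℝ →ₐ[ℝ] ℂ) A.charmatrix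
  rw [AlgHom.mapMatrix_apply, AlgHom.mapMatrix_apply] at hadj
  rw [resolventMatrix, Matrix.inv_def, det_smul_one_sub, Ring.inverse_eq_inv', Matrix.smul_apply,
    ← charmatrix_map_aeval, ← hadj, smul_eq_mul, div_eq_inv_mul, Matrix.map_apply]

open Polynomial in
variable (A) in
lemma natDegree_adjugate_charmatrix_lt (i j : Fin n) :
    (A.charmatrix.adjugate i j).natDegree < n := by
  cases n with
  | zero => exact i.elim0
  | succ m =>
    let minor (M : Matrix (Fin (m + 1)) (Fin (m + 1)) ℝ) : Matrix (Fin m) (Fin m) ℝ :=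
      M.submatrix j.succAbove i.succAbove
    have hminor : A.charmatrix.submatrix j.succAbove i.succAbove =
        (X : ℝ[X]) • (minor 1).map C + (minor (-A)).map C := by
      ext1 k l
      simp only [minor, Matrix.submatrix_apply, Matrix.charmatrix_apply, Matrix.add_apply,
        Matrix.smul_apply, Matrix.map_apply, Matrix.diagonal_apply, Matrix.one_apply,
        Matrix.neg_apply, smul_eq_mul]
      split_ifs <;> simp [sub_eq_add_neg]
    have hdet := natDegree_det_X_add_C_le (minor 1) (minor (-A))
    rw [← hminor, Fintype.card_fin] at hdet
    have hsign : ((-1 : ℝ[X]) ^ (j + i : ℕ)).natDegree = 0 := by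
      rcases neg_one_pow_eq_or ℝ[X] (j + i : ℕ) with h | h <;> rw [h] <;> simp
    rw [Matrix.adjugate_fin_succ_eq_det_submatrix, Nat.lt_succ_iff]
    refine natDegree_mul_le.trans ?_
    rwa [hsign, zero_add]

namespace IsHurwitz

lemma isStablePoly_charpoly (hA : IsHurwitz A) : IsStablePoly A.charpoly := by
  intro z hz
  have hmap : (A.map (algebraMap ℝ ℂ)).charpoly = A.charpoly.map (algebraMap ℝ ℂ) :=
    Matrix.charpoly_map A (algebraMap ℝ ℂ)
  refine hA z ?_
  rw [Matrix.mem_spectrum_iff_isRoot_charpoly, hmap, Polynomial.IsRoot.def,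
    Polynomial.eval_map_algebraMap, hz]

lemma resolventMatrix_mul (hA : IsHurwitz A) {s : ℂ} (hs : 0 ≤ s.re) :
    resolventMatrix A s * (s • (1 : Matrix (Fin n) (Fin n) ℂ) - A.map (algebraMap ℝ ℂ)) = 1 := by
  refine Matrix.nonsing_inv_mul _ ?_
  rw [det_smul_one_sub, isUnit_iff_ne_zero]
  exact hA.isStablePoly_charpoly.aeval_ne_zero hs

lemma exists_isImpulseResponse_resolvent (hA : IsHurwitz A) (i j : Fin n) :
    ∃ d h, IsImpulseResponse (fun s => resolventMatrix A s i j) d h := by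
  obtain ⟨d, h, H⟩ := exists_isImpulseResponse_div (p := A.charmatrix.adjugate i j)
    hA.isStablePoly_charpoly (by
      rw [Matrix.charpoly_natDegree_eq_dim, Fintype.card_fin]
      exact (natDegree_adjugate_charmatrix_lt A i j).le)
  exact ⟨d, h, H.congr fun s _ => resolventMatrix_apply A s i j⟩

/-- The matrix of stable systems with transfer function `(s I - A)⁻¹`. -/
def resolvent (hA : IsHurwitz A) : Matrix (Fin n) (Fin n) StableSys :=
  Matrix.of fun i j => StableSys.mk _ (hA.exists_isImpulseResponse_resolvent i j)

lemma realizes_resolvent (hA : IsHurwitz A) (i j : Fin n) :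
    (hA.resolvent i j).Realizes fun s => resolventMatrix A s i j :=
  StableSys.realizes_mk (hA.exists_isImpulseResponse_resolvent i j)

lemma resolvent_eq_lag_smul (hA : IsHurwitz A) :
    hA.resolvent = lag • (1 + hA.resolvent * (1 + A.map StableSys.const)) := by
  refine Matrix.ext fun i j => StableSys.ext_evalHom fun s => ?_
  let ev := StableSys.evalHom s
  have hres : hA.resolvent.map ev = resolventMatrix A s :=
    Matrix.ext fun i j => (hA.realizes_resolvent i j).evalHom_eq s
  have hmap : (lag • (1 + hA.resolvent * (1 + A.map StableSys.const))).map ev =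
      ((s : ℂ) + 1)⁻¹ • (1 + resolventMatrix A s * (1 + A.map (algebraMap ℝ ℂ))) := by
    rw [Matrix.map_smul' _ _ _ (map_mul ev), Matrix.map_add _ (map_add ev), Matrix.map_mul,
      Matrix.map_add _ (map_add ev), Matrix.map_one _ (map_zero ev) (map_one ev), hres,
      Matrix.map_map]
    rfl
  have hs1 : (s : ℂ) + 1 ≠ 0 := fun h => by
    have hre := congrArg Complex.re h
    simp only [Complex.add_re, Complex.one_re, Complex.zero_re] at hre
    linarith [s.2]
  have hmul := hA.resolventMatrix_mul s.2
  rw [mul_sub, mul_smul_comm, mul_one, sub_eq_iff_eq_add] at hmul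
  have key : resolventMatrix A s =
      ((s : ℂ) + 1)⁻¹ • (1 + resolventMatrix A s * (1 + A.map (algebraMap ℝ ℂ))) := by
    rw [eq_inv_smul_iff₀ hs1, add_smul, one_smul, hmul, mul_add, mul_one]
    abel
  rw [← hmap, ← hres] at key
  exact congrFun (congrFun key i) j

end IsHurwitz

end Resolvent

-- Multiply `z = a • (B • z + f)` by `1 + E * B`, for which `a • (1 + E * B) = E`.
open scoped Matrix.Module in
lemma eq_smul_of_eq_smul_add {R M ι : Type*} [CommRing R] [AddCommGroup M] [Module R M] [Fintype ι]
    [DecidableEq ι] {B E : Matrix ι ι R} {a : R} {z f : ι → M} (hE : E = a • (1 + E * B))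
    (hz : z = a • (B • z + f)) : z = E • f := by
  have hcomm : (1 + E * B) • a • (B • z + f) = (a • (1 + E * B)) • (B • z + f) := by
    funext i
    simp only [Matrix.Module.smul_apply, Pi.smul_apply, Matrix.smul_apply, smul_smul, smul_eq_mul,
      mul_comm a]
  have h : (E * B) • z + z = (E * B) • z + E • f := by
    calc (E * B) • z + z = (1 + E * B) • z := by rw [add_smul, one_smul, add_comm]
      _ = (1 + E * B) • a • (B • z + f) := congrArg _ hz
      _ = E • (B • z + f) := by rw [hcomm, ← hE]
      _ = (E * B) • z + E • f := by rw [smul_add, mul_smul]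
  exact add_left_cancel h

namespace IsHurwitz

variable {n : ℕ} {A : Matrix (Fin n) (Fin n) ℝ}

lemma eq_sum_resolvent_smul (hA : IsHurwitz A) {z f : Fin n → Sig} (hz0 : ∀ i, z i 0 = 0)
    (hz : ∀ i t, 0 ≤ t → HasDerivWithinAt (z i) (∑ j, A i j * z j t + f i t) (Ici 0) t)
    (i : Fin n) : z i = ∑ j, hA.resolvent i j • f j := by
  have hlag (i : Fin n) :
      z i = lag • (∑ j, (1 + A.map StableSys.const) i j • z j + f i) := by
    have hsum : ∑ j, (1 + A.map StableSys.const) i j • z j = z i + ∑ j, A i j • z j := by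
      simp only [Matrix.add_apply, Matrix.map_apply, add_smul, Finset.sum_add_distrib,
        StableSys.const_smul, Matrix.one_apply, ite_smul, one_smul, zero_smul,
        Finset.sum_ite_eq, Finset.mem_univ, if_true]
    rw [hsum, add_assoc]
    refine eq_lag_smul (hz0 i) fun t ht => (hz i t ht).congr_deriv ?_
    simp only [Sig.add_apply, Sig.sum_apply, Sig.smul_apply]
  exact congrFun (eq_smul_of_eq_smul_add hA.resolvent_eq_lag_smul (funext hlag)) i

-- Subtracting `e⁻ᵗ z(0)` makes the initial state vanish.
lemma exists_bound (hA : IsHurwitz A) {z : ℝ → Fin n → ℝ}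
    (hz : ∀ t, 0 ≤ t → HasDerivWithinAt z (A *ᵥ z t) (Ici 0) t) (i : Fin n) :
    ∃ M : ℝ, ∀ t, 0 ≤ t → |z t i| ≤ M := by
  have hzi (i) (t) (ht : 0 ≤ t) := hasDerivWithinAt_pi.1 (hz t ht) i
  have hc (i) : ContinuousOn (fun t => z t i - Real.exp (-t) * z 0 i) (Ici 0) :=
    ContinuousOn.sub (fun t ht => (hzi i t ht).continuousWithinAt) (by fun_prop)
  let Z (i : Fin n) : Sig := Sig.of _ (hc i)
  let f (i : Fin n) : Sig := Sig.of (fun t => Real.exp (-t) * ((A *ᵥ z 0) i + z 0 i)) (by fun_prop)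
  have hexp {t : ℝ} (ht : 0 ≤ t) (a : ℝ) : |Real.exp (-t) * a| ≤ |a| := by
    rw [abs_mul, Real.abs_exp]
    exact mul_le_of_le_one_left (abs_nonneg a) (by simpa using ht)
  have hf (j : Fin n) : ∀ t, 0 ≤ t → |f j t| ≤ |(A *ᵥ z 0) j + z 0 j| := fun t ht => by
    simpa only [f, Sig.of_apply _ ht] using hexp ht _
  have hZ := hA.eq_sum_resolvent_smul (z := Z) (f := f)
    (fun i => by simp [Z, Sig.of_apply _ le_rfl])
    (fun i t ht => by
      have hexp' : HasDerivAt (fun t => Real.exp (-t) * z 0 i) (-Real.exp (-t) * z 0 i) t := by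
        simpa using ((hasDerivAt_id t).neg.exp).mul_const (z 0 i)
      refine (((hzi i t ht).sub hexp'.hasDerivWithinAt).congr
        (fun τ hτ => Sig.of_apply (hc i) hτ) (Sig.of_apply (hc i) ht)).congr_deriv ?_
      simp only [Z, f, Sig.of_apply _ ht, Matrix.mulVec, dotProduct, mul_sub,
        Finset.sum_sub_distrib, mul_left_comm _ (Real.exp (-t)), ← Finset.mul_sum]
      ring) i
  have hR (j : Fin n) : ∃ M, ∀ t, |(hA.resolvent i j • f j) t| ≤ M :=
    have ⟨_, _, H⟩ := hA.exists_isImpulseResponse_resolvent i j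
    ⟨_, (hA.realizes_resolvent i j).abs_smul_le H (hf j)⟩
  choose M hM using hR
  refine ⟨∑ j, M j + |z 0 i|, fun t ht => ?_⟩
  have hzt : z t i = (∑ j, hA.resolvent i j • f j) t + Real.exp (-t) * z 0 i := by
    rw [← hZ, Sig.of_apply _ ht, sub_add_cancel]
  rw [hzt, Sig.sum_apply]
  exact (abs_add_le _ _).trans (add_le_add
    ((Finset.abs_sum_le_sum_abs _ _).trans (Finset.sum_le_sum fun j _ => hM j t)) (hexp ht _))

end IsHurwitz

/-! ### The Lyapunov equation -/

lemma semiconjBy_aeval {R A : Type*} [CommSemiring R] [Semiring A] [Algebra R A] {m a b : A}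
    (h : SemiconjBy m a b) (p : Polynomial R) :
    SemiconjBy m (Polynomial.aeval a p) (Polynomial.aeval b p) := by
  induction p using Polynomial.induction_on' with
  | add p q hp hq => simpa only [map_add] using hp.add_right hq
  | monomial k r =>
    rw [Polynomial.aeval_monomial, Polynomial.aeval_monomial]
    exact SemiconjBy.mul_right (Algebra.commutes r m).symm (h.pow_right k)

-- If `W 0 > 0`, Grönwall's inequality makes `W` grow exponentially.
lemma nonpos_of_mul_le_deriv_of_le {W W' : ℝ → ℝ} {κ B : ℝ} (hκ : 0 < κ)
    (hW : ∀ t, HasDerivAt W (W' t) t) (hgrow : ∀ t, κ * W t ≤ W' t)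
    (hB : ∀ t, 0 ≤ t → W t ≤ B) : W 0 ≤ 0 := by
  have hderiv (t) : HasDerivAt (fun t => Real.exp (-(κ * t)) * W t)
      (Real.exp (-(κ * t)) * (W' t - κ * W t)) t := by
    have hexp : HasDerivAt (fun t => Real.exp (-(κ * t))) (Real.exp (-(κ * t)) * -κ) t := by
      simpa using ((hasDerivAt_id t).const_mul κ).neg.exp
    exact (hexp.mul (hW t)).congr_deriv (by ring)
  have hmono : Monotone fun t => Real.exp (-(κ * t)) * W t :=
    monotone_of_deriv_nonneg (fun t => (hderiv t).differentiableAt) fun t => by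
      rw [(hderiv t).deriv]
      exact mul_nonneg (Real.exp_nonneg _) (sub_nonneg.2 (hgrow t))
  have hle (t) (ht : 0 ≤ t) : W 0 ≤ Real.exp (-(κ * t)) * B := by
    calc W 0 = Real.exp (-(κ * 0)) * W 0 := by simp
      _ ≤ Real.exp (-(κ * t)) * W t := hmono ht
      _ ≤ Real.exp (-(κ * t)) * B := by gcongr; exact hB t ht
  have hlim : Tendsto (fun t => Real.exp (-(κ * t)) * B) atTop (𝓝 0) := by
    simpa using (Real.tendsto_exp_neg_atTop_nhds_zero.comp
      (tendsto_id.const_mul_atTop hκ)).mul_const B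
  exact ge_of_tendsto hlim ((eventually_ge_atTop 0).mono hle)

section Lyapunov

variable {n : ℕ} {A P Q : Matrix (Fin n) (Fin n) ℝ}

lemma continuousOn_dotProduct {u v : ℝ → Fin n → ℝ} {s : Set ℝ} (hu : ContinuousOn u s)
    (hv : ContinuousOn v s) : ContinuousOn (fun t => u t ⬝ᵥ v t) s := by
  simp only [dotProduct]
  fun_prop

lemma hasDerivWithinAt_dotProduct {u v : ℝ → Fin n → ℝ} {u' v' : Fin n → ℝ} {s : Set ℝ} {t : ℝ}
    (hu : HasDerivWithinAt u u' s t) (hv : HasDerivWithinAt v v' s t) :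
    HasDerivWithinAt (fun τ => u τ ⬝ᵥ v τ) (u' ⬝ᵥ v t + u t ⬝ᵥ v') s t := by
  have hsum := HasDerivWithinAt.fun_sum (u := Finset.univ) fun i _ =>
    (hasDerivWithinAt_pi.1 hu i).mul (hasDerivWithinAt_pi.1 hv i)
  refine hsum.congr_deriv ?_
  simp only [dotProduct, Finset.sum_add_distrib]

lemma hasDerivWithinAt_mulVec (P : Matrix (Fin n) (Fin n) ℝ) {u : ℝ → Fin n → ℝ} {u' : Fin n → ℝ}
    {s : Set ℝ} {t : ℝ} (hu : HasDerivWithinAt u u' s t) :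
    HasDerivWithinAt (fun τ => P *ᵥ u τ) (P *ᵥ u') s t :=
  hasDerivWithinAt_pi.2 fun i => HasDerivWithinAt.fun_sum (u := Finset.univ) fun j _ =>
    (hasDerivWithinAt_pi.1 hu j).const_mul (P i j)

lemma dotProduct_mulVec_add_of_lyapunov (h : Aᵀ * P + P * A = -Q) (z : Fin n → ℝ) :
    (A *ᵥ z) ⬝ᵥ (P *ᵥ z) + z ⬝ᵥ (P *ᵥ (A *ᵥ z)) = -(z ⬝ᵥ (Q *ᵥ z)) := by
  have htranspose : (A *ᵥ z) ⬝ᵥ (P *ᵥ z) = z ⬝ᵥ ((Aᵀ * P) *ᵥ z) := by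
    rw [← Matrix.mulVec_mulVec, Matrix.dotProduct_mulVec z, Matrix.vecMul_transpose]
  rw [htranspose, Matrix.mulVec_mulVec, ← dotProduct_add, ← Matrix.add_mulVec, h,
    Matrix.neg_mulVec, dotProduct_neg]

-- `M` intertwines `-A` and `Aᵀ`, so `M * p(-A) = p(Aᵀ) * M = 0` for the characteristic polynomial
-- `p` of `A`, and `p(-A)` is invertible because `p` and `p(-X)` have no common zero.
lemma IsHurwitz.eq_zero_of_lyapunov (hA : IsHurwitz A) {M : Matrix (Fin n) (Fin n) ℝ}
    (hM : Aᵀ * M + M * A = 0) : M = 0 := by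
  have hsemi : SemiconjBy M (-A) Aᵀ := by
    rw [SemiconjBy, mul_neg]
    exact (eq_neg_of_add_eq_zero_left hM).symm
  have hzero : M * Polynomial.aeval (-A) A.charpoly = 0 := by
    rw [(semiconjBy_aeval hsemi A.charpoly).eq, ← Matrix.charpoly_transpose,
      Matrix.aeval_self_charpoly, zero_mul]
  have hcoprime : IsCoprime A.charpoly (A.charpoly.comp (-Polynomial.X)) := by
    refine (Polynomial.isCoprime_iff_aeval_ne_zero_of_isAlgClosed ℝ ℂ _ _).2 fun z => ?_
    by_contra! hz
    rw [Polynomial.aeval_comp, map_neg, Polynomial.aeval_X] at hz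
    have hneg := hA.isStablePoly_charpoly (-z) hz.2
    rw [Complex.neg_re] at hneg
    linarith [hA.isStablePoly_charpoly z hz.1]
  obtain ⟨u, v, huv⟩ := hcoprime
  have hunit := congrArg (Polynomial.aeval A) huv
  rw [map_add, map_mul, map_mul, Matrix.aeval_self_charpoly, mul_zero, zero_add,
    Polynomial.aeval_comp, map_one, map_neg, Polynomial.aeval_X, mul_eq_one_comm] at hunit
  rw [← mul_one M, ← hunit, ← mul_assoc, hzero, zero_mul]

lemma IsHurwitz.isHermitian_of_lyapunov (hA : IsHurwitz A) (hQ : Q.IsHermitian)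
    (h : Aᵀ * P + P * A = -Q) : P.IsHermitian := by
  rw [Matrix.IsHermitian, Matrix.conjTranspose_eq_transpose_of_trivial] at hQ ⊢
  have htranspose : Aᵀ * Pᵀ + Pᵀ * A = -Q := by
    rw [add_comm]
    simpa only [Matrix.transpose_add, Matrix.transpose_mul, Matrix.transpose_transpose,
      Matrix.transpose_neg, hQ] using congrArg Matrix.transpose h
  refine sub_eq_zero.1 (hA.eq_zero_of_lyapunov ?_)
  rw [mul_sub, sub_mul, sub_add_sub_comm, htranspose, h, sub_self]

lemma lambdaMin_mul_le (hP : P.IsHermitian) (z : Fin n → ℝ) :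
    lambdaMin P * (z ⬝ᵥ z) ≤ z ⬝ᵥ (P *ᵥ z) := by
  have hbdd : BddBelow (spectrum ℝ P) := by
    rw [hP.spectrum_real_eq_range_eigenvalues]
    exact (finite_range _).bddBelow
  have hpsd : (P - algebraMap ℝ (Matrix (Fin n) (Fin n) ℝ) (lambdaMin P)).PosSemidef := by
    rw [Matrix.posSemidef_iff_isHermitian_and_spectrum_nonneg]
    refine ⟨hP.sub ?_, ?_⟩
    · rw [Matrix.algebraMap_eq_diagonal]
      exact Matrix.isHermitian_diagonal _
    · rw [← spectrum.sub_singleton_eq]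
      rintro _ ⟨a, ha, _, rfl, rfl⟩
      exact sub_nonneg.2 (csInf_le hbdd ha)
  have hnonneg := hpsd.dotProduct_mulVec_nonneg z
  rwa [Matrix.sub_mulVec, dotProduct_sub, Algebra.algebraMap_eq_smul_one, Matrix.smul_mulVec,
    Matrix.one_mulVec, dotProduct_smul, star_trivial, sub_nonneg, smul_eq_mul] at hnonneg

lemma lambdaMin_pos (hn : 1 ≤ n) (hP : P.PosDef) : 0 < lambdaMin P := by
  have : Nonempty (Fin n) := ⟨⟨0, hn⟩⟩
  rw [lambdaMin, hP.1.spectrum_real_eq_range_eigenvalues]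
  obtain ⟨i, hi⟩ := (range_nonempty hP.1.eigenvalues).csInf_mem (finite_range _)
  rw [← hi]
  exact hP.eigenvalues_pos i

lemma sq_le_dotProduct_self (z : Fin n → ℝ) (i : Fin n) : z i ^ 2 ≤ z ⬝ᵥ z := by
  simp only [dotProduct, ← sq]
  exact Finset.single_le_sum (f := fun i => z i ^ 2) (fun _ _ => sq_nonneg _) (Finset.mem_univ i)

lemma abs_dotProduct_mulVec_le (P : Matrix (Fin n) (Fin n) ℝ) (z : Fin n → ℝ) :
    |z ⬝ᵥ (P *ᵥ z)| ≤ (∑ i, ∑ j, |P i j|) * (z ⬝ᵥ z) := by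
  have hmul (i j : Fin n) : |z i| * |z j| ≤ z ⬝ᵥ z := by
    have hi := sq_le_dotProduct_self z i
    have hj := sq_le_dotProduct_self z j
    rw [← sq_abs] at hi hj
    nlinarith [sq_nonneg (|z i| - |z j|)]
  generalize z ⬝ᵥ z = m at hmul
  simp only [Matrix.mulVec, dotProduct, Finset.mul_sum, Finset.sum_mul]
  refine (Finset.abs_sum_le_sum_abs _ _).trans (Finset.sum_le_sum fun i _ =>
    (Finset.abs_sum_le_sum_abs _ _).trans (Finset.sum_le_sum fun j _ => ?_))
  rw [mul_left_comm, abs_mul, abs_mul]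
  exact mul_le_mul_of_nonneg_left (hmul i j) (abs_nonneg _)

attribute [local instance] Matrix.linftyOpNormedRing Matrix.linftyOpNormedAlgebra in
lemma hasDerivAt_exp_smul_mulVec (A : Matrix (Fin n) (Fin n) ℝ) (x : Fin n → ℝ) (t : ℝ) :
    HasDerivAt (fun τ : ℝ => NormedSpace.exp (τ • A) *ᵥ x) (A *ᵥ (NormedSpace.exp (t • A) *ᵥ x))
      t := by
  have hL := (LinearMap.toContinuousLinearMap
    ((Matrix.mulVecBilin ℝ ℝ).flip x : Matrix (Fin n) (Fin n) ℝ →ₗ[ℝ] Fin n → ℝ)).hasFDerivAt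
    |>.comp_hasDerivAt t (hasDerivAt_exp_smul_const' (𝕂 := ℝ) A t)
  exact hL.congr_deriv (Matrix.mulVec_mulVec x A (NormedSpace.exp (t • A))).symm

-- Along `z' = A z` the function `W = -zᵀ P z` satisfies `W' = zᵀ Q z ≥ κ W`, and it is bounded.
lemma IsHurwitz.posSemidef_of_lyapunov (hn : 1 ≤ n) (hA : IsHurwitz A) (hQ : Q.PosDef)
    (h : Aᵀ * P + P * A = -Q) : P.PosSemidef := by
  have hsymm := hA.isHermitian_of_lyapunov hQ.1 h
  refine Matrix.PosSemidef.of_dotProduct_mulVec_nonneg hsymm fun x => ?_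
  let z (t : ℝ) : Fin n → ℝ := NormedSpace.exp (t • A) *ᵥ x
  have hz (t) : HasDerivAt z (A *ᵥ z t) t := hasDerivAt_exp_smul_mulVec A x t
  let p := (∑ i, ∑ j, |P i j|) + 1
  have hp : 0 < p := by positivity
  have hPz (t) : -(z t ⬝ᵥ (P *ᵥ z t)) ≤ p * (z t ⬝ᵥ z t) :=
    (neg_le_abs _).trans ((abs_dotProduct_mulVec_le P (z t)).trans
      (mul_le_mul_of_nonneg_right (le_add_of_nonneg_right zero_le_one)
        (dotProduct_self_star_nonneg (z t))))
  have hderiv (t) : HasDerivAt (fun t => -(z t ⬝ᵥ (P *ᵥ z t))) (z t ⬝ᵥ (Q *ᵥ z t)) t := by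
    have hzt := (hz t).hasDerivWithinAt (s := univ)
    have hV := (hasDerivWithinAt_dotProduct hzt (hasDerivWithinAt_mulVec P hzt)).neg
    rwa [hasDerivWithinAt_univ, dotProduct_mulVec_add_of_lyapunov h, neg_neg] at hV
  have hlam := lambdaMin_pos hn hQ
  have hgrow (t) : lambdaMin Q / p * -(z t ⬝ᵥ (P *ᵥ z t)) ≤ z t ⬝ᵥ (Q *ᵥ z t) := by
    calc lambdaMin Q / p * -(z t ⬝ᵥ (P *ᵥ z t)) ≤ lambdaMin Q / p * (p * (z t ⬝ᵥ z t)) := by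
          gcongr; exact hPz t
      _ = lambdaMin Q * (z t ⬝ᵥ z t) := by field_simp
      _ ≤ z t ⬝ᵥ (Q *ᵥ z t) := lambdaMin_mul_le hQ.1 (z t)
  choose M hM using hA.exists_bound fun t _ => (hz t).hasDerivWithinAt
  have hbound (t) (ht : 0 ≤ t) : -(z t ⬝ᵥ (P *ᵥ z t)) ≤ p * ∑ i, M i ^ 2 := by
    refine (hPz t).trans (mul_le_mul_of_nonneg_left ?_ hp.le)
    simp only [dotProduct, ← sq]
    exact Finset.sum_le_sum fun i _ => sq_le_sq.2 ((hM i t ht).trans (le_abs_self _))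
  have hx := nonpos_of_mul_le_deriv_of_le (div_pos hlam hp) hderiv hgrow hbound
  simpa [z] using hx

lemma IsHurwitz.posDef_of_lyapunov (hn : 1 ≤ n) (hA : IsHurwitz A) (hQ : Q.PosDef)
    (h : Aᵀ * P + P * A = -Q) : P.PosDef := by
  have hpsd := hA.posSemidef_of_lyapunov hn hQ h
  refine Matrix.PosDef.of_dotProduct_mulVec_pos hpsd.1 fun x hx => ?_
  refine (hpsd.dotProduct_mulVec_nonneg x).lt_of_ne' fun hzero => ?_
  have hPx : P *ᵥ x = 0 := (hpsd.dotProduct_mulVec_zero_iff x).1 hzero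
  have hQx := dotProduct_mulVec_add_of_lyapunov h x
  rw [Matrix.dotProduct_mulVec x, ← Matrix.mulVec_transpose,
    ← Matrix.conjTranspose_eq_transpose_of_trivial, hpsd.1.eq, hPx, dotProduct_zero,
    zero_dotProduct, add_zero, zero_eq_neg] at hQx
  exact (hQ.dotProduct_mulVec_pos hx).ne' hQx

end Lyapunov

/-! ### The prediction error -/

section Projection

variable {n : ℕ} {Ω : Set (Fin n → ℝ)} {θ y v z : Fin n → ℝ}

lemma add_smul_mem_tangentCone (hΩ : Convex ℝ Ω) (hz : z ∈ Ω) {ε : ℝ} (hε : 0 < ε)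
    (hv : v ∈ tangentCone Ω θ) : v + ε • (z - θ) ∈ tangentCone Ω θ := by
  refine map_mem_closure (f := fun v => v + ε • (z - θ)) (by fun_prop) hv ?_
  rintro _ ⟨a, ha, z', hz', rfl⟩
  have hpos : 0 < a + ε := by linarith
  refine ⟨a + ε, hpos.le, (a / (a + ε)) • z' + (ε / (a + ε)) • z,
    hΩ hz' hz (by positivity) (by positivity) (by field_simp), ?_⟩
  ext i
  simp only [Pi.add_apply, Pi.smul_apply, Pi.sub_apply, smul_eq_mul]
  field_simp
  ring

-- Compare `v` with the competitors `v + ε (z - θ)` and let `ε` tend to `0`.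
lemma IsProj.dotProduct_le (h : IsProj Ω θ y v) (hΩ : Convex ℝ Ω) (hz : z ∈ Ω) :
    (θ - z) ⬝ᵥ v ≤ (θ - z) ⬝ᵥ y := by
  have hcompetitor (ε : ℝ) (hε : 0 < ε) :
      2 * ((y - v) ⬝ᵥ (z - θ)) ≤ ε * ((z - θ) ⬝ᵥ (z - θ)) := by
    have hle := h.2 _ (add_smul_mem_tangentCone hΩ hz hε h.1)
    have hexpand : ∑ i, (y i - (v + ε • (z - θ)) i) ^ 2 = ∑ i, (y i - v i) ^ 2 +
        ε * (ε * ((z - θ) ⬝ᵥ (z - θ)) - 2 * ((y - v) ⬝ᵥ (z - θ))) := by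
      simp only [dotProduct, Finset.mul_sum, ← Finset.sum_sub_distrib, ← Finset.sum_add_distrib,
        Pi.add_apply, Pi.smul_apply, Pi.sub_apply, smul_eq_mul]
      exact Finset.sum_congr rfl fun i _ => by ring
    rw [hexpand, le_add_iff_nonneg_right] at hle
    exact sub_nonneg.1 (nonneg_of_mul_nonneg_right hle hε)
  have hlim : Tendsto (fun ε : ℝ => ε * ((z - θ) ⬝ᵥ (z - θ))) (𝓝[>] 0) (𝓝 0) :=
    tendsto_nhdsWithin_of_tendsto_nhds <| by
      simpa only [zero_mul, id] using
        (tendsto_id (α := ℝ) (x := 𝓝 0)).mul_const ((z - θ) ⬝ᵥ (z - θ))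
  have hnonpos : 2 * ((y - v) ⬝ᵥ (z - θ)) ≤ 0 :=
    ge_of_tendsto hlim (eventually_mem_nhdsWithin.mono hcompetitor)
  have hneg : (y - v) ⬝ᵥ (z - θ) = (θ - z) ⬝ᵥ v - (θ - z) ⬝ᵥ y := by
    rw [dotProduct_comm, ← neg_sub θ z, neg_dotProduct, dotProduct_sub, neg_sub]
  linarith

end Projection

section Primitive

lemma sq_sub_sq_eq_integral {g : ℝ → ℝ} {t : ℝ} (a : ℝ) (hg : IntervalIntegrable g volume 0 t) :
    (a + ∫ τ in (0 : ℝ)..t, g τ) ^ 2 - a ^ 2 =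
      ∫ σ in (0 : ℝ)..t, 2 * ((a + ∫ τ in (0 : ℝ)..σ, g τ) * g σ) := by
  have hac : AbsolutelyContinuousOnInterval (fun σ => a + ∫ τ in (0 : ℝ)..σ, g τ) 0 t :=
    (LipschitzWith.const a).lipschitzOnWith.absolutelyContinuousOnInterval.add
      (hg.absolutelyContinuousOnInterval_intervalIntegral (c := 0) (by simp))
  have hparts := hac.integral_deriv_mul_eq_sub hac
  rw [intervalIntegral.integral_same, add_zero, ← sq, ← sq] at hparts
  rw [← hparts]
  refine intervalIntegral.integral_congr_ae ?_
  filter_upwards [hg.ae_hasDerivAt_integral] with σ hσ hσ'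
  rw [((hσ (uIoc_subset_uIcc hσ') 0 (by simp)).const_add a).deriv]
  ring

variable {n : ℕ} {v θ : ℝ → Fin n → ℝ} {a : Fin n → ℝ} {t : ℝ}

lemma intervalIntegral_apply (hv : IntervalIntegrable v volume 0 t) (i : Fin n) :
    (∫ τ in (0 : ℝ)..t, v τ) i = ∫ τ in (0 : ℝ)..t, v τ i :=
  ((ContinuousLinearMap.proj (R := ℝ) (φ := fun _ : Fin n => ℝ) i).intervalIntegral_comp_comm
    hv).symm

lemma intervalIntegrable_apply (hv : IntervalIntegrable v volume 0 t) (i : Fin n) :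
    IntervalIntegrable (fun τ => v τ i) volume 0 t :=
  ⟨hv.1.eval i, hv.2.eval i⟩

lemma intervalIntegrable_dotProduct (hθ : ContinuousOn θ (uIcc 0 t))
    (hv : IntervalIntegrable v volume 0 t) :
    IntervalIntegrable (fun τ => θ τ ⬝ᵥ v τ) volume 0 t := by
  refine (IntervalIntegrable.sum Finset.univ fun i _ =>
    (intervalIntegrable_apply hv i).continuousOn_mul (continuousOn_pi.1 hθ i)).congr ?_
  exact fun τ _ => by simp only [Finset.sum_apply, dotProduct]

lemma continuousOn_of_eq_add_integral (hv : IntervalIntegrable v volume 0 t)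
    (hθ : ∀ σ ∈ uIcc 0 t, θ σ = a + ∫ τ in (0 : ℝ)..σ, v τ) : ContinuousOn θ (uIcc 0 t) :=
  (continuousOn_const.add
    (intervalIntegral.continuousOn_primitive_interval' hv left_mem_uIcc)).congr hθ

lemma dotProduct_self_sub_eq_integral (hv : IntervalIntegrable v volume 0 t)
    (hθ : ∀ σ ∈ uIcc 0 t, θ σ = a + ∫ τ in (0 : ℝ)..σ, v τ) :
    θ t ⬝ᵥ θ t - a ⬝ᵥ a = ∫ σ in (0 : ℝ)..t, 2 * (θ σ ⬝ᵥ v σ) := by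
  have hcoord (i) (σ) (hσ : σ ∈ uIcc 0 t) : θ σ i = a i + ∫ τ in (0 : ℝ)..σ, v τ i := by
    rw [hθ σ hσ, Pi.add_apply,
      intervalIntegral_apply (hv.mono_set (uIcc_subset_uIcc_left hσ))]
  have hsq (i) : θ t i ^ 2 - a i ^ 2 = ∫ σ in (0 : ℝ)..t, 2 * (θ σ i * v σ i) := by
    rw [hcoord i t right_mem_uIcc, sq_sub_sq_eq_integral _ (intervalIntegrable_apply hv i)]
    exact intervalIntegral.integral_congr fun σ hσ => by simp only [hcoord i σ hσ]
  have hint (i) : IntervalIntegrable (fun σ => 2 * (θ σ i * v σ i)) volume 0 t :=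
    ((intervalIntegrable_apply hv i).continuousOn_mul
      (continuousOn_pi.1 (continuousOn_of_eq_add_integral hv hθ) i)).const_mul 2
  simp only [dotProduct, Finset.mul_sum]
  rw [intervalIntegral.integral_finsetSum fun i _ => hint i, ← Finset.sum_sub_distrib]
  exact Finset.sum_congr rfl fun i _ => by rw [← hsq, sq, sq]

end Primitive

namespace Setup

variable {n : ℕ} {S : Setup n} {x xhat θhat : ℝ → Fin n → ℝ} {u u₂ : ℝ → ℝ}

/-- A weakening of `Setup.Standing`, for data with an arbitrary static filter gain `C(0)`, a
possibly unbounded reference signal `r` and a bounded convex set `Ω`. -/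
structure Admissible (S : Setup n) : Prop where
  controllable : IsControllable S.A S.b
  bounded : Bornology.IsBounded S.Ω
  convex : Convex ℝ S.Ω
  θ_mem : S.θ ∈ S.Ω
  hurwitz : IsHurwitz S.Am
  Q_posDef : S.Q.PosDef
  lyapunov : S.Amᵀ * S.P + S.P * S.Am = -S.Q
  filter_strictlyProper : S.filter.num.degree < S.filter.denom.degree
  filter_stable : IsStablePoly S.filter.denom
  Γc_pos : 0 < S.Γc
  θhat₀_mem : S.θhat₀ ∈ S.Ω
  r_continuous : ContinuousOn S.r (Ici 0)

lemma Standing.admissible (hS : S.Standing) : S.Admissible where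
  controllable := hS.controllable
  bounded := hS.compact.isBounded
  convex := hS.convex
  θ_mem := hS.θ_mem
  hurwitz := hS.hurwitz
  Q_posDef := hS.Q_posDef
  lyapunov := hS.lyapunov
  filter_strictlyProper := hS.filter_strictlyProper
  filter_stable := hS.filter_stable
  Γc_pos := hS.Γc_pos
  θhat₀_mem := hS.θhat₀_mem
  r_continuous := hS.r_continuous

lemma Am_mulVec (z : Fin n → ℝ) : S.Am *ᵥ z = S.A *ᵥ z - (S.K ⬝ᵥ z) • S.b := by
  rw [Am, Matrix.sub_mulVec, Matrix.vecMulVec_mulVec, op_smul_eq_smul]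

/-- The term by which the prediction error and the parameter error are coupled in the derivative of
the Lyapunov function `x̃ᵀ P x̃ + |θ̃|² / Γ_c`, where `x̃ = x̂ - x` and `θ̃ = θ̂ - θ`: it enters the
derivatives of the two summands with opposite signs. -/
def coupling (S : Setup n) (x xhat θhat : ℝ → Fin n → ℝ) (t : ℝ) : ℝ :=
  ((xhat t - x t) ⬝ᵥ (S.P *ᵥ S.b)) * ((θhat t - S.θ) ⬝ᵥ x t)

namespace IsClosedLoop

lemma hasDerivWithinAt (hx : S.IsClosedLoop x xhat θhat u u₂) {t : ℝ} (ht : 0 ≤ t) :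
    HasDerivWithinAt x (S.Am *ᵥ x t + (u₂ t - S.θ ⬝ᵥ x t) • S.b) (Ici 0) t := by
  refine (hx.plant.2 t ht).congr_deriv ?_
  rw [Am_mulVec, hx.control t ht]
  module

lemma hasDerivWithinAt_error (hx : S.IsClosedLoop x xhat θhat u u₂) {t : ℝ} (ht : 0 ≤ t) :
    HasDerivWithinAt (fun t => xhat t - x t)
      (S.Am *ᵥ (xhat t - x t) + (-((θhat t - S.θ) ⬝ᵥ x t)) • S.b) (Ici 0) t := by
  refine ((hx.predictor t ht).sub (hx.hasDerivWithinAt ht)).congr_deriv ?_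
  rw [Matrix.mulVec_sub, sub_dotProduct]
  module

lemma continuousOn (hx : S.IsClosedLoop x xhat θhat u u₂) : ContinuousOn x (Ici 0) :=
  fun t ht => (hx.plant.2 t ht).continuousWithinAt

lemma continuousOn_error (hx : S.IsClosedLoop x xhat θhat u u₂) :
    ContinuousOn (fun t => xhat t - x t) (Ici 0) :=
  fun _ ht => (hx.hasDerivWithinAt_error ht).continuousWithinAt

lemma continuousOn_estimate (hx : S.IsClosedLoop x xhat θhat u u₂) :
    ContinuousOn θhat (Ici 0) := by
  obtain ⟨v, -, hv⟩ := hx.adaptation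
  intro t ht
  have ht' : 0 ≤ t + 1 := by linarith [mem_Ici.1 ht]
  have hcont : ContinuousOn θhat (Icc 0 (t + 1)) := by
    rw [← uIcc_of_le ht']
    refine continuousOn_of_eq_add_integral ((hv _ ht').1.smul S.Γc) fun σ hσ => (hv σ ?_).2
    exact (uIcc_of_le ht' ▸ hσ).1
  refine (hcont t ⟨ht, by linarith⟩).mono_of_mem_nhdsWithin ?_
  rw [← Ici_inter_Iic]
  exact inter_mem_nhdsWithin _ (Iic_mem_nhds (by linarith))

lemma continuousOn_coupling (hx : S.IsClosedLoop x xhat θhat u u₂) :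
    ContinuousOn (S.coupling x xhat θhat) (Ici 0) :=
  (continuousOn_dotProduct hx.continuousOn_error continuousOn_const).mul
    (continuousOn_dotProduct (hx.continuousOn_estimate.sub continuousOn_const) hx.continuousOn)

lemma hasDerivWithinAt_quadForm (hS : S.Admissible) (hx : S.IsClosedLoop x xhat θhat u u₂) {t : ℝ}
    (ht : 0 ≤ t) :
    HasDerivWithinAt (fun t => (xhat t - x t) ⬝ᵥ (S.P *ᵥ (xhat t - x t)))
      (-((xhat t - x t) ⬝ᵥ (S.Q *ᵥ (xhat t - x t))) - 2 * S.coupling x xhat θhat t)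
      (Ici 0) t := by
  have herr := hx.hasDerivWithinAt_error ht
  have hsymm := hS.hurwitz.isHermitian_of_lyapunov hS.Q_posDef.1 hS.lyapunov
  refine (hasDerivWithinAt_dotProduct herr (hasDerivWithinAt_mulVec S.P herr)).congr_deriv ?_
  rw [coupling]
  generalize xhat t - x t = e
  have hPb : S.b ⬝ᵥ (S.P *ᵥ e) = e ⬝ᵥ (S.P *ᵥ S.b) := by
    rw [Matrix.dotProduct_mulVec, dotProduct_comm, ← Matrix.mulVec_transpose,
      ← Matrix.conjTranspose_eq_transpose_of_trivial, hsymm.eq]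
  rw [Matrix.mulVec_add, add_dotProduct, dotProduct_add,
    ← dotProduct_mulVec_add_of_lyapunov hS.lyapunov, Matrix.mulVec_smul, smul_dotProduct,
    dotProduct_smul, hPb, smul_eq_mul]
  ring

lemma quadForm_le (hS : S.Admissible) (hx : S.IsClosedLoop x xhat θhat u u₂) {t : ℝ}
    (ht : 0 ≤ t) :
    (xhat t - x t) ⬝ᵥ (S.P *ᵥ (xhat t - x t)) ≤
      ∫ τ in (0 : ℝ)..t, -(2 * S.coupling x xhat θhat τ) := by
  have hsub : Icc 0 t ⊆ Ici (0 : ℝ) := Icc_subset_Ici_self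
  have hint : IntegrableOn (fun τ => -(2 * S.coupling x xhat θhat τ)) (Icc 0 t) :=
    ((continuousOn_const.mul (hx.continuousOn_coupling.mono hsub)).neg).integrableOn_Icc
  have hle := intervalIntegral.sub_le_integral_of_hasDeriv_right_of_le ht
    (fun τ hτ => ((hx.hasDerivWithinAt_quadForm hS hτ.1).mono hsub).continuousWithinAt)
    (fun τ hτ => (hx.hasDerivWithinAt_quadForm hS hτ.1.le).mono (Ioi_subset_Ici hτ.1.le)) hint
    fun τ _ => by
      have hQ := hS.Q_posDef.posSemidef.dotProduct_mulVec_nonneg (xhat τ - x τ)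
      rw [star_trivial] at hQ
      linarith
  simpa [hx.predictor_init, hx.plant.1] using hle

lemma sq_estimate_sub_le (hS : S.Admissible) (hx : S.IsClosedLoop x xhat θhat u u₂) {t : ℝ}
    (ht : 0 ≤ t) :
    (θhat t - S.θ) ⬝ᵥ (θhat t - S.θ) - (S.θhat₀ - S.θ) ⬝ᵥ (S.θhat₀ - S.θ) ≤
      S.Γc * ∫ τ in (0 : ℝ)..t, 2 * S.coupling x xhat θhat τ := by
  obtain ⟨v, hproj, hv⟩ := hx.adaptation
  have hint : IntervalIntegrable (fun τ => S.Γc • v τ) volume 0 t := (hv t ht).1.smul S.Γc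
  have hθ (σ) (hσ : σ ∈ uIcc 0 t) :
      θhat σ - S.θ = S.θhat₀ - S.θ + ∫ τ in (0 : ℝ)..σ, S.Γc • v τ := by
    rw [(hv σ (uIcc_of_le ht ▸ hσ).1).2, add_sub_right_comm]
  have hcoupling : IntervalIntegrable (S.coupling x xhat θhat) volume 0 t :=
    (hx.continuousOn_coupling.mono (uIcc_of_le ht ▸ Icc_subset_Ici_self)).intervalIntegrable
  rw [dotProduct_self_sub_eq_integral hint hθ, ← intervalIntegral.integral_const_mul]
  refine intervalIntegral.integral_mono_on ht
    ((intervalIntegrable_dotProduct (continuousOn_of_eq_add_integral hint hθ) hint).const_mul 2)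
    ((hcoupling.const_mul 2).const_mul S.Γc) fun τ hτ => ?_
  have hvar := (hproj τ hτ.1).dotProduct_le hS.convex hS.θ_mem
  rw [dotProduct_smul, smul_eq_mul] at hvar
  rw [dotProduct_smul, smul_eq_mul, mul_left_comm]
  gcongr
  · exact hS.Γc_pos.le
  · exact hvar

lemma lyapunov_le (hS : S.Admissible) (hx : S.IsClosedLoop x xhat θhat u u₂) {t : ℝ} (ht : 0 ≤ t) :
    S.Γc * ((xhat t - x t) ⬝ᵥ (S.P *ᵥ (xhat t - x t))) ≤
      (S.θhat₀ - S.θ) ⬝ᵥ (S.θhat₀ - S.θ) := by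
  have herr := mul_le_mul_of_nonneg_left (hx.quadForm_le hS ht) hS.Γc_pos.le
  have hest := hx.sq_estimate_sub_le hS ht
  have hnonneg := dotProduct_self_star_nonneg (θhat t - S.θ)
  rw [intervalIntegral.integral_neg, mul_neg] at herr
  rw [star_trivial] at hnonneg
  linarith

end IsClosedLoop

lemma Admissible.bddAbove_image (hS : S.Admissible) {f : (Fin n → ℝ) → ℝ} (hf : Continuous f) :
    BddAbove (f '' S.Ω) :=
  (hS.bounded.isCompact_closure.image hf).bddAbove.mono (image_mono subset_closure)

lemma Admissible.sum_four_sq_le (hS : S.Admissible) {ϑ : Fin n → ℝ} (hϑ : ϑ ∈ S.Ω) :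
    ∑ i, 4 * ϑ i ^ 2 ≤ S.thetaBarMax :=
  le_csSup (hS.bddAbove_image (by fun_prop)) ⟨ϑ, hϑ, rfl⟩

lemma Admissible.sum_abs_le (hS : S.Admissible) {ϑ : Fin n → ℝ} (hϑ : ϑ ∈ S.Ω) :
    ∑ i, |ϑ i| ≤ S.thetaMax :=
  le_csSup (hS.bddAbove_image (by fun_prop)) ⟨ϑ, hϑ, rfl⟩

lemma Admissible.dotProduct_sub_le (hS : S.Admissible) {ϑ ϑ' : Fin n → ℝ} (hϑ : ϑ ∈ S.Ω)
    (hϑ' : ϑ' ∈ S.Ω) : (ϑ - ϑ') ⬝ᵥ (ϑ - ϑ') ≤ S.thetaBarMax := by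
  have hle : (ϑ - ϑ') ⬝ᵥ (ϑ - ϑ') ≤ ∑ i, (4 * ϑ i ^ 2 / 2 + 4 * ϑ' i ^ 2 / 2) :=
    Finset.sum_le_sum fun i _ => by
      rw [Pi.sub_apply]
      nlinarith [sq_nonneg (ϑ i + ϑ' i)]
  rw [Finset.sum_add_distrib, ← Finset.sum_div, ← Finset.sum_div] at hle
  linarith [hS.sum_four_sq_le hϑ, hS.sum_four_sq_le hϑ']

lemma IsClosedLoop.abs_error_le (hn : 1 ≤ n) (hS : S.Admissible)
    (hx : S.IsClosedLoop x xhat θhat u u₂) {t : ℝ} (ht : 0 ≤ t) (i : Fin n) :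
    |xhat t i - x t i| ≤ √(S.thetaBarMax / lambdaMin S.P) / √S.Γc := by
  have hP := hS.hurwitz.posDef_of_lyapunov hn hS.Q_posDef hS.lyapunov
  have hlam := lambdaMin_pos hn hP
  have hΓ := hS.Γc_pos
  rw [← Real.sqrt_div' _ hΓ.le]
  refine Real.abs_le_sqrt ?_
  rw [div_div, le_div_iff₀' (mul_pos hlam hΓ)]
  calc lambdaMin S.P * S.Γc * (xhat t i - x t i) ^ 2
      = S.Γc * (lambdaMin S.P * (xhat t - x t) i ^ 2) := by rw [Pi.sub_apply]; ring
    _ ≤ S.Γc * (lambdaMin S.P * ((xhat t - x t) ⬝ᵥ (xhat t - x t))) := by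
        gcongr; exact sq_le_dotProduct_self _ i
    _ ≤ S.Γc * ((xhat t - x t) ⬝ᵥ (S.P *ᵥ (xhat t - x t))) := by
        gcongr; exact lambdaMin_mul_le hP.1 _
    _ ≤ S.thetaBarMax := (hx.lyapunov_le hS ht).trans (hS.dotProduct_sub_le hS.θhat₀_mem hS.θ_mem)

end Setup

/-! ### Outputs of relative degree one -/

lemma IsControllable.eq_zero {n : ℕ} {A : Matrix (Fin n) (Fin n) ℝ} {b co : Fin n → ℝ}
    (h : IsControllable A b) (hco : ∀ k : ℕ, co ⬝ᵥ (A ^ k *ᵥ b) = 0) : co = 0 := by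
  let M : Matrix (Fin n) (Fin n) ℝ := Matrix.of fun i k : Fin n => (A ^ (k : ℕ) *ᵥ b) i
  have hrange : LinearMap.range M.mulVecLin = ⊤ :=
    Submodule.eq_top_of_finrank_eq (h.trans (Module.finrank_fin_fun ℝ).symm)
  obtain ⟨y, hy⟩ := LinearMap.range_eq_top.1 hrange co
  have hker : co ᵥ* M = 0 := funext fun k => hco k
  have hself : co ⬝ᵥ co = 0 := by
    nth_rewrite 2 [← hy]
    rw [Matrix.mulVecLin_apply, Matrix.dotProduct_mulVec, hker, zero_dotProduct]
  exact dotProduct_self_eq_zero.1 hself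

lemma dotProduct_pow_mulVec_eq_zero_of_sub_vecMulVec {n : ℕ} {A : Matrix (Fin n) (Fin n) ℝ}
    {b K co : Fin n → ℝ} (h : ∀ k : ℕ, co ⬝ᵥ ((A - Matrix.vecMulVec b K) ^ k *ᵥ b) = 0) (k : ℕ) :
    co ⬝ᵥ (A ^ k *ᵥ b) = 0 := by
  induction k generalizing co with
  | zero => simpa using h 0
  | succ k ih =>
    have hb : co ⬝ᵥ b = 0 := by simpa using h 0
    have hfeedback : co ᵥ* (A - Matrix.vecMulVec b K) = co ᵥ* A := by
      rw [Matrix.vecMul_sub, Matrix.vecMul_vecMulVec, hb, zero_smul, sub_zero]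
    rw [pow_succ', ← Matrix.mulVec_mulVec, Matrix.dotProduct_mulVec]
    refine ih fun m => ?_
    rw [← hfeedback, ← Matrix.dotProduct_mulVec, Matrix.mulVec_mulVec, ← pow_succ']
    exact h (m + 1)

section TransferNumerator

open Polynomial

variable {n : ℕ} (A : Matrix (Fin n) (Fin n) ℝ) (b : Fin n → ℝ)

/-- The numerators of the entries of `(s I - A)⁻¹ b` over the characteristic polynomial of `A`. -/
def transferNum : Fin n → ℝ[X] := A.charmatrix.adjugate *ᵥ fun j => C (b j)

lemma degree_transferNum_lt (i : Fin n) : (transferNum A b i).degree < n := by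
  rw [transferNum, Matrix.mulVec, dotProduct]
  refine (degree_sum_le _ _).trans_lt ((Finset.sup_lt_iff (WithBot.bot_lt_coe n)).2 fun j _ => ?_)
  refine (degree_mul_le _ _).trans_lt ?_
  calc (A.charmatrix.adjugate i j).degree + (C (b j)).degree
      ≤ (A.charmatrix.adjugate i j).natDegree + 0 :=
        add_le_add degree_le_natDegree degree_C_le
    _ < n := by
        rw [add_zero]
        exact_mod_cast natDegree_adjugate_charmatrix_lt A i j

lemma resolventMatrix_mulVec_apply (s : ℂ) (i : Fin n) :
    (resolventMatrix A s *ᵥ fun j => (b j : ℂ)) i =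
      aeval s (transferNum A b i) / aeval s A.charpoly := by
  simp only [transferNum, Matrix.mulVec, dotProduct, map_sum, Finset.sum_div]
  refine Finset.sum_congr rfl fun j _ => ?_
  rw [resolventMatrix_apply, map_mul, aeval_C, Complex.coe_algebraMap, div_mul_eq_mul_div]

lemma X_mul_transferNum (i : Fin n) :
    X * transferNum A b i = ∑ j, A i j • transferNum A b j + b i • A.charpoly := by
  have hadj := congrArg (fun M => (M *ᵥ fun j => C (b j)) i) (Matrix.mul_adjugate A.charmatrix)
  simp only [← Matrix.mulVec_mulVec, Matrix.smul_mulVec, Matrix.one_mulVec] at hadj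
  change (A.charmatrix *ᵥ transferNum A b) i = _ at hadj
  rw [Matrix.charmatrix, Matrix.sub_mulVec] at hadj
  simp only [Matrix.scalar_apply, Pi.sub_apply, Matrix.mulVec_diagonal, Pi.smul_apply,
    smul_eq_mul] at hadj
  rw [sub_eq_iff_eq_add'.1 hadj, smul_eq_C_mul, mul_comm (C (b i))]
  simp only [smul_eq_C_mul]
  rfl

/-- The numerator of `coᵀ (s I - A)⁻¹ b` over the characteristic polynomial of `A`, as a function of
`co`. -/
def outputNum : (Fin n → ℝ) →ₗ[ℝ] degreeLT ℝ n :=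
  (Fintype.linearCombination ℝ (transferNum A b)).codRestrict (degreeLT ℝ n) fun co =>
    (degreeLT ℝ n).sum_mem (t := Finset.univ) fun i _ =>
      Submodule.smul_mem _ (co i) (mem_degreeLT.2 (degree_transferNum_lt A b i))

lemma coe_outputNum (co : Fin n → ℝ) :
    (outputNum A b co : ℝ[X]) = ∑ i, co i • transferNum A b i := rfl

lemma dotProduct_resolventMatrix_mulVec (co : Fin n → ℝ) (s : ℂ) :
    (fun i => (co i : ℂ)) ⬝ᵥ (resolventMatrix A s *ᵥ fun j => (b j : ℂ)) =
      aeval s (outputNum A b co : ℝ[X]) / aeval s A.charpoly := by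
  simp only [coe_outputNum, dotProduct, resolventMatrix_mulVec_apply, map_sum, map_smul,
    Finset.sum_div, Complex.real_smul, mul_div_assoc]

lemma X_mul_outputNum (co : Fin n → ℝ) :
    X * (outputNum A b co : ℝ[X]) =
      (outputNum A b (co ᵥ* A) : ℝ[X]) + (co ⬝ᵥ b) • A.charpoly := by
  simp only [coe_outputNum, Finset.mul_sum, mul_smul_comm, X_mul_transferNum, smul_add,
    Finset.sum_add_distrib, Finset.smul_sum, smul_smul, Matrix.vecMul, dotProduct, Finset.sum_smul]
  rw [Finset.sum_comm]

variable {A b} {co : Fin n → ℝ}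

-- In `X * 0 = outputNum (co A) + (co ⬝ b) • charpoly`, only the last term can have degree `n`.
lemma outputNum_vecMul_eq_zero (h : outputNum A b co = 0) :
    outputNum A b (co ᵥ* A) = 0 ∧ co ⬝ᵥ b = 0 := by
  have hX := X_mul_outputNum A b co
  rw [h, ZeroMemClass.coe_zero, mul_zero] at hX
  have hb : co ⬝ᵥ b = 0 := by
    by_contra hne
    have hlt := mem_degreeLT.1 (outputNum A b (co ᵥ* A)).2
    rw [eq_neg_of_add_eq_zero_left hX.symm, degree_neg, smul_eq_C_mul, degree_C_mul hne,
      Matrix.charpoly_degree_eq_dim, Fintype.card_fin] at hlt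
    exact lt_irrefl _ hlt
  rw [hb, zero_smul, add_zero] at hX
  exact ⟨Subtype.ext hX.symm, hb⟩

lemma dotProduct_pow_mulVec_eq_zero_of_outputNum_eq_zero (h : outputNum A b co = 0) (k : ℕ) :
    co ⬝ᵥ (A ^ k *ᵥ b) = 0 := by
  induction k generalizing co with
  | zero => simpa using (outputNum_vecMul_eq_zero h).2
  | succ k ih =>
    rw [pow_succ', ← Matrix.mulVec_mulVec, Matrix.dotProduct_mulVec]
    exact ih (outputNum_vecMul_eq_zero h).1

lemma outputNum_surjective (h : ∀ co, (∀ k : ℕ, co ⬝ᵥ (A ^ k *ᵥ b) = 0) → co = 0) :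
    Function.Surjective (outputNum A b) := by
  have hinj : Function.Injective (outputNum A b) :=
    (injective_iff_map_eq_zero _).2 fun co hco =>
      h co (dotProduct_pow_mulVec_eq_zero_of_outputNum_eq_zero hco)
  have hequiv : Function.Injective ((degreeLTEquiv ℝ n).toLinearMap ∘ₗ outputNum A b) :=
    (degreeLTEquiv ℝ n).injective.comp hinj
  have hsurj := (degreeLTEquiv ℝ n).symm.surjective.comp
    (LinearMap.injective_iff_surjective.1 hequiv)
  convert hsurj
  ext1 co
  simp

end TransferNumerator

namespace Setup

open Polynomial

variable {n : ℕ} {S : Setup n}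

lemma coHo_eq_div (co : Fin n → ℝ) (s : ℂ) :
    S.coHo co s = aeval s (outputNum S.Am S.b co : ℝ[X]) / aeval s S.Am.charpoly :=
  dotProduct_resolventMatrix_mulVec S.Am S.b co s

-- Choose `co` such that the numerator of `coᵀ H_o(s)` is `(s + 1) ^ (n - 1)`.
lemma exists_isMinPhaseRelDegOne (hn : 1 ≤ n) (hc : IsControllable S.A S.b)
    (hA : IsHurwitz S.Am) : ∃ co : Fin n → ℝ, S.IsMinPhaseRelDegOne co := by
  have hdeg : ((X + 1 : ℝ[X]) ^ (n - 1)).natDegree = n - 1 := by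
    rw [natDegree_pow, ← C_1, natDegree_X_add_C, mul_one]
  have hmem : (X + 1 : ℝ[X]) ^ (n - 1) ∈ degreeLT ℝ n := by
    refine mem_degreeLT.2 (degree_le_natDegree.trans_lt ?_)
    rw [hdeg]
    exact_mod_cast Nat.sub_lt hn one_pos
  obtain ⟨co, hco⟩ := outputNum_surjective (A := S.Am) (b := S.b)
    (fun co h => hc.eq_zero (dotProduct_pow_mulVec_eq_zero_of_sub_vecMulVec h)) ⟨_, hmem⟩
  refine ⟨co, (X + 1) ^ (n - 1), S.Am.charpoly, fun z hz => ?_, hA.isStablePoly_charpoly, ?_,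
    fun s _ => by rw [coHo_eq_div, hco]⟩
  · rw [map_pow, map_add, aeval_X, map_one] at hz
    rw [eq_neg_of_add_eq_zero_left (eq_zero_of_pow_eq_zero hz)]
    simp
  · rw [hdeg, Matrix.charpoly_natDegree_eq_dim, Fintype.card_fin, Nat.sub_add_cancel hn]

end Setup

/-! ### Gains of systems with several channels -/

section MultiGain

variable {ι κ : Type*} [Fintype κ] {H : ℂ → Matrix ι κ ℂ}

lemma l1Gain_lt_top [Finite ι] (hH : ∀ i j, ∃ d h, IsImpulseResponse (fun s => H s i j) d h) :
    l1Gain H < ∞ := by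
  have hrow (i : ι) : ∑ j, sisoL1Gain (fun s => H s i j) < ∞ :=
    ENNReal.sum_lt_top.2 fun j _ => sisoL1Gain_lt_top (hH i j)
  cases nonempty_fintype ι
  rw [l1Gain, ← Finset.sup_univ_eq_iSup, Finset.sup_lt_iff ENNReal.zero_lt_top]
  exact fun i _ => hrow i

lemma ofReal_abs_sum_smul_le {i : ι} {F : κ → StableSys}
    (hF : ∀ j, (F j).Realizes fun s => H s i j) {w : κ → Sig} {N : ℝ≥0∞} (hN : N ≠ ∞)
    (hw : ∀ j t, 0 ≤ t → ENNReal.ofReal |w j t| ≤ N) (t : ℝ) :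
    ENNReal.ofReal |(∑ j, F j • w j) t| ≤ l1Gain H * N := by
  have hchannel (j : κ) : ENNReal.ofReal |(F j • w j) t| ≤ sisoL1Gain (fun s => H s i j) * N := by
    rw [← ENNReal.ofReal_toReal hN]
    exact (hF j).ofReal_abs_smul_le
      (fun t ht => (ENNReal.ofReal_le_iff_le_toReal hN).1 (hw j t ht)) t
  calc ENNReal.ofReal |(∑ j, F j • w j) t|
      ≤ ∑ j, ENNReal.ofReal |(F j • w j) t| := by
        rw [Sig.sum_apply, ← ENNReal.ofReal_sum_of_nonneg fun j _ => abs_nonneg _]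
        exact ENNReal.ofReal_le_ofReal (Finset.abs_sum_le_sum_abs _ _)
    _ ≤ (∑ j, sisoL1Gain fun s => H s i j) * N := by
        rw [Finset.sum_mul]
        exact Finset.sum_le_sum fun j _ => hchannel j
    _ ≤ l1Gain H * N := by
        gcongr
        exact le_iSup (fun i => ∑ j, sisoL1Gain fun s => H s i j) i

lemma ofReal_norm_dotProduct_le_l1Gain (ϑ : κ → ℝ) (G : ℂ → κ → ℂ) {s : ℂ} (hs : 0 ≤ s.re) :
    ENNReal.ofReal ‖(fun i => (ϑ i : ℂ)) ⬝ᵥ G s‖ ≤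
      l1Gain (fun s => Matrix.replicateCol Unit (G s)) * ENNReal.ofReal (∑ i, |ϑ i|) := by
  have hentry (i : κ) :
      ENNReal.ofReal ‖G s i‖ ≤ l1Gain fun s => Matrix.replicateCol Unit (G s) := by
    refine (ofReal_norm_le_sisoL1Gain (G := fun s => G s i) hs).trans ?_
    refine le_iSup_of_le i ?_
    simp only [Matrix.replicateCol_apply, Finset.univ_unique, Finset.sum_singleton, le_refl]
  rw [ENNReal.ofReal_sum_of_nonneg fun i _ => abs_nonneg _, Finset.mul_sum]
  calc ENNReal.ofReal ‖(fun i => (ϑ i : ℂ)) ⬝ᵥ G s‖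
      ≤ ENNReal.ofReal (∑ i, ‖G s i‖ * |ϑ i|) := by
        refine ENNReal.ofReal_le_ofReal ((norm_sum_le _ _).trans_eq ?_)
        simp only [norm_mul, Complex.norm_real, Real.norm_eq_abs, mul_comm]
    _ = ∑ i, ENNReal.ofReal ‖G s i‖ * ENNReal.ofReal |ϑ i| := by
        rw [ENNReal.ofReal_sum_of_nonneg fun i _ => by positivity]
        simp only [ENNReal.ofReal_mul (norm_nonneg _)]
    _ ≤ _ := Finset.sum_le_sum fun i _ => by gcongr; exact hentry i

lemma linftyNorm_le {ξ : ℝ → ι → ℝ} {N : ℝ≥0∞}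
    (h : ∀ i t, 0 ≤ t → ENNReal.ofReal |ξ t i| ≤ N) : linftyNorm ξ ≤ N :=
  iSup_le fun i => iSup₂_le (h i)

lemma StableSys.sum_const_smul_apply (a : κ → ℝ) (w : κ → Sig) (t : ℝ) :
    (∑ j, const (a j) • w j) t = a ⬝ᵥ fun j => w j t := by
  simp only [Sig.sum_apply, const_smul, Sig.smul_apply, dotProduct]

end MultiGain

/-! ### Feedback loops -/

open Polynomial in
lemma exists_isImpulseResponse_inv_one_sub {L : ℂ → ℂ} {p q : ℝ[X]} (hq : IsStablePoly q)
    (hpq : p.degree < q.degree) (hL : ∀ s : ℂ, 0 ≤ s.re → L s = aeval s p / aeval s q)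
    (hne : ∀ s : ℂ, 0 ≤ s.re → L s ≠ 1) :
    ∃ d h, IsImpulseResponse (fun s => (1 - L s)⁻¹) d h := by
  have hfactor {s : ℂ} (hs : 0 ≤ s.re) : aeval s (q - p) = aeval s q * (1 - L s) := by
    rw [hL s hs, map_sub, mul_sub, mul_one, mul_div_cancel₀ _ (hq.aeval_ne_zero hs)]
  have hstable : IsStablePoly (q - p) := fun z hz => by
    by_contra! hre
    rw [hfactor hre] at hz
    exact mul_ne_zero (hq.aeval_ne_zero hre) (sub_ne_zero.2 (hne z hre).symm) hz
  obtain ⟨d, h, H⟩ := exists_isImpulseResponse_div (p := q) hstable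
    (natDegree_eq_of_degree_eq (degree_sub_eq_left_of_degree_lt hpq)).ge
  refine ⟨d, h, H.congr fun s hs => ?_⟩
  rw [hfactor hs, div_mul_cancel_left₀ (hq.aeval_ne_zero hs)]

section RankOne

variable {R M ι : Type*} [CommRing R] [AddCommGroup M] [Module R M] [Fintype ι] [DecidableEq ι]
  {g ϑ : ι → R} {σ : R}

lemma one_sub_vecMulVec_mul (h : σ * (1 - ϑ ⬝ᵥ g) = 1) :
    (1 - Matrix.vecMulVec g ϑ) * (1 + σ • Matrix.vecMulVec g ϑ) = 1 := by
  have hsq : Matrix.vecMulVec g ϑ * Matrix.vecMulVec g ϑ = (ϑ ⬝ᵥ g) • Matrix.vecMulVec g ϑ := by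
    rw [Matrix.vecMulVec_mul_vecMulVec, Matrix.vecMulVec_smul]
  calc (1 - Matrix.vecMulVec g ϑ) * (1 + σ • Matrix.vecMulVec g ϑ)
      = 1 + (σ * (1 - ϑ ⬝ᵥ g) - 1) • Matrix.vecMulVec g ϑ := by
        rw [sub_mul, one_mul, mul_add, mul_one, mul_smul_comm, hsq]
        module
    _ = 1 := by rw [h, sub_self, zero_smul, add_zero]

open scoped Matrix.Module in
lemma eq_smul_of_eq_smul_sum_add (h : σ * (1 - ϑ ⬝ᵥ g) = 1) {e f : ι → M}
    (he : ∀ i, e i = g i • ∑ j, ϑ j • e j + f i) :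
    e = (1 + σ • Matrix.vecMulVec g ϑ) • f := by
  have hloop : (1 - Matrix.vecMulVec g ϑ) • e = f := by
    rw [sub_smul, one_smul, sub_eq_iff_eq_add']
    funext i
    simp only [he i, Matrix.Module.smul_apply, Pi.add_apply, Matrix.vecMulVec_apply, mul_smul,
      Finset.smul_sum]
  rw [← hloop, smul_smul, mul_eq_one_comm.1 (one_sub_vecMulVec_mul h), one_smul]

end RankOne

namespace Setup

variable {n : ℕ} {S : Setup n} {co : Fin n → ℝ}

/-! ### The transfer functions of the control loop -/

lemma C_eq_div (s : ℂ) :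
    S.C s = Polynomial.aeval s S.filter.num / Polynomial.aeval s S.filter.denom := rfl

variable (S) in
/-- The loop transfer function `θᵀ Ḡ(s)`, whose gain is the subject of the small-gain condition. -/
def loopGain (s : ℂ) : ℂ := (fun i => (S.θ i : ℂ)) ⬝ᵥ S.Gbar s

lemma loopGain_eq_coHo_mul (s : ℂ) : S.loopGain s = S.coHo S.θ s * (S.C s - 1) := by
  simp only [loopGain, coHo, Gbar, dotProduct, Finset.sum_mul, mul_assoc]

lemma H2_eq_smul {s : ℂ} (hs : S.loopGain s ≠ 1) :
    S.H2 s = S.C s • (1 + (1 - S.loopGain s)⁻¹ • S.GbarTheta s) := by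
  set T := S.GbarTheta s
  set σ := (1 - S.loopGain s)⁻¹
  have hinv : (1 - T) * (1 + σ • T) = 1 :=
    one_sub_vecMulVec_mul (inv_mul_cancel₀ (sub_ne_zero.2 hs.symm))
  have hsplit : T + (S.C s - 1) • (1 : Matrix (Fin n) (Fin n) ℂ) = S.C s • 1 - (1 - T) := by
    module
  rw [H2, hsplit, mul_sub, Matrix.nonsing_inv_mul _ (Matrix.isUnit_det_of_right_inverse hinv),
    Matrix.inv_eq_right_inv hinv, mul_smul_comm, mul_one, add_sub_cancel]

lemma IsMinPhaseRelDegOne.coHo_ne_zero (hco : S.IsMinPhaseRelDegOne co) {s : ℂ} (hs : 0 ≤ s.re) :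
    S.coHo co s ≠ 0 := by
  obtain ⟨Nn, Nd, hNn, hNd, -, hH⟩ := hco
  rw [hH s hs]
  exact div_ne_zero (hNn.aeval_ne_zero hs) (hNd.aeval_ne_zero hs)

namespace Admissible

variable (hS : S.Admissible)

include hS

/-- The filter `C(s)` as a stable system. -/
def Csys : StableSys :=
  StableSys.mk S.C (exists_isImpulseResponse_div hS.filter_stable
    (Polynomial.natDegree_le_natDegree hS.filter_strictlyProper.le))

lemma realizes_Csys : hS.Csys.Realizes S.C := StableSys.realizes_mk _

/-- The entries of `H_o(s)` as stable systems. -/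
def Hosys : Fin n → StableSys := hS.hurwitz.resolvent *ᵥ fun j => StableSys.const (S.b j)

lemma realizes_Hosys (i : Fin n) : (hS.Hosys i).Realizes fun s => S.Ho s i := fun s => by
  refine (map_sum (StableSys.evalHom s) _ _).trans (Finset.sum_congr rfl fun j _ => ?_)
  rw [map_mul, (hS.hurwitz.realizes_resolvent i j).evalHom_eq,
    (StableSys.realizes_const _).evalHom_eq]
  rfl

/-- The entries of `Ḡ(s)` as stable systems. -/
def Gsys (i : Fin n) : StableSys := hS.Hosys i * (hS.Csys - 1)

lemma realizes_Gsys (i : Fin n) : (hS.Gsys i).Realizes fun s => S.Gbar s i := fun s => by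
  refine (map_mul (StableSys.evalHom s) _ _).trans ?_
  rw [map_sub, map_one, (hS.realizes_Hosys i).evalHom_eq, hS.realizes_Csys.evalHom_eq]
  rfl

lemma norm_loopGain_lt_one (hgain : S.GainCondition) {s : ℂ} (hs : 0 ≤ s.re) :
    ‖S.loopGain s‖ < 1 := by
  refine ENNReal.ofReal_lt_one.1 (lt_of_le_of_lt ?_ hgain)
  refine (ofReal_norm_dotProduct_le_l1Gain S.θ S.Gbar hs).trans ?_
  gcongr
  exact hS.sum_abs_le hS.θ_mem

lemma loopGain_ne_one (hgain : S.GainCondition) {s : ℂ} (hs : 0 ≤ s.re) : S.loopGain s ≠ 1 :=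
  fun h => by simpa only [h, norm_one, lt_irrefl] using hS.norm_loopGain_lt_one hgain hs

open Polynomial in
lemma exists_isImpulseResponse_sensitivity (hgain : S.GainCondition) :
    ∃ d h, IsImpulseResponse (fun s => (1 - S.loopGain s)⁻¹) d h := by
  set a : ℝ[X] := (outputNum S.Am S.b S.θ : ℝ[X])
  set p := S.filter.num
  set q := S.filter.denom
  have hq : q ≠ 0 := hS.filter_stable.ne_zero
  refine exists_isImpulseResponse_inv_one_sub (p := a * (p - q)) (q := S.Am.charpoly * q)
    (hS.hurwitz.isStablePoly_charpoly.mul hS.filter_stable) ?_ (fun s hs => ?_)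
    fun s hs => hS.loopGain_ne_one hgain hs
  · have ha : a.degree < S.Am.charpoly.degree := by
      rw [Matrix.charpoly_degree_eq_dim, Fintype.card_fin]
      exact mem_degreeLT.1 (outputNum S.Am S.b S.θ).2
    rw [degree_mul, degree_mul, degree_sub_eq_right_of_degree_lt hS.filter_strictlyProper]
    exact WithBot.add_lt_add_right (degree_ne_bot.2 hq) ha
  · have hqs : aeval s q ≠ 0 := hS.filter_stable.aeval_ne_zero hs
    rw [loopGain_eq_coHo_mul, coHo_eq_div, C_eq_div, div_sub_one hqs, div_mul_div_comm, map_mul,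
      map_mul, map_sub]

/-- The sensitivity `1 / (1 - θᵀ Ḡ(s))` as a stable system. -/
def sens (hgain : S.GainCondition) : StableSys :=
  StableSys.mk _ (hS.exists_isImpulseResponse_sensitivity hgain)

lemma realizes_sens (hgain : S.GainCondition) :
    (hS.sens hgain).Realizes fun s => (1 - S.loopGain s)⁻¹ := StableSys.realizes_mk _

lemma sens_mul (hgain : S.GainCondition) :
    hS.sens hgain * (1 - (fun j => StableSys.const (S.θ j)) ⬝ᵥ hS.Gsys) = 1 :=
  StableSys.ext_evalHom fun s => by
    have hloop : StableSys.evalHom s ((fun j => StableSys.const (S.θ j)) ⬝ᵥ hS.Gsys) =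
        S.loopGain s := by
      simp only [dotProduct, map_sum, map_mul, (StableSys.realizes_const _).evalHom_eq,
        (hS.realizes_Gsys _).evalHom_eq, loopGain]
    rw [map_mul, map_sub, map_one, hloop, (hS.realizes_sens hgain).evalHom_eq]
    exact inv_mul_cancel₀ (sub_ne_zero.2 (hS.loopGain_ne_one hgain s.2).symm)

/-- The entries of `H₂(s)` as stable systems, in the form
`H₂ = C (I + (1 - θᵀ Ḡ)⁻¹ Ḡ θᵀ)`. -/
def H2sys (hgain : S.GainCondition) : Matrix (Fin n) (Fin n) StableSys :=
  hS.Csys • (1 + hS.sens hgain • Matrix.vecMulVec hS.Gsys fun j => StableSys.const (S.θ j))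

lemma realizes_H2sys (hgain : S.GainCondition) (i j : Fin n) :
    (hS.H2sys hgain i j).Realizes fun s => S.H2 s i j := fun s => by
  change StableSys.evalHom s (hS.H2sys hgain i j) = S.H2 s i j
  rw [H2_eq_smul (hS.loopGain_ne_one hgain s.2), H2sys]
  simp only [Matrix.smul_apply, Matrix.add_apply, Matrix.one_apply, GbarTheta,
    Matrix.vecMulVec_apply, smul_eq_mul, map_mul, map_add, apply_ite (StableSys.evalHom s), map_one,
    map_zero, hS.realizes_Csys.evalHom_eq, (hS.realizes_sens hgain).evalHom_eq,
    (hS.realizes_Gsys i).evalHom_eq, (StableSys.realizes_const _).evalHom_eq]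

/-- The entries of `C(s) θᵀ - Kᵀ` as stable systems. -/
def feedbackSys (i : Fin n) : StableSys :=
  hS.Csys * StableSys.const (S.θ i) - StableSys.const (S.K i)

lemma realizes_feedbackSys (i : Fin n) :
    (hS.feedbackSys i).Realizes fun s => S.C s * (S.θ i : ℂ) - (S.K i : ℂ) := fun s => by
  refine (map_sub (StableSys.evalHom s) _ _).trans ?_
  rw [map_mul, hS.realizes_Csys.evalHom_eq,
    (StableSys.realizes_const _).evalHom_eq, (StableSys.realizes_const _).evalHom_eq]

open Polynomial in
lemma exists_isImpulseResponse_C_div_coHo (hco : S.IsMinPhaseRelDegOne co) :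
    ∃ d h, IsImpulseResponse (fun s => S.C s * (1 / S.coHo co s)) d h := by
  obtain ⟨Nn, Nd, hNn, hNd, hdeg, hH⟩ := hco
  have hproper : (S.filter.num * Nd).natDegree ≤ (S.filter.denom * Nn).natDegree := by
    rcases eq_or_ne S.filter.num 0 with hnum | hnum
    · rw [hnum, zero_mul, natDegree_zero]
      exact Nat.zero_le _
    · have hlt := natDegree_lt_natDegree hnum hS.filter_strictlyProper
      rw [natDegree_mul hnum hNd.ne_zero, natDegree_mul hS.filter_stable.ne_zero hNn.ne_zero]
      lia
  obtain ⟨d, h, H⟩ := exists_isImpulseResponse_div (hS.filter_stable.mul hNn) hproper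
  refine ⟨d, h, H.congr fun s hs => ?_⟩
  rw [hH s hs, C_eq_div, map_mul, map_mul, one_div_div, div_mul_div_comm]

/-- The inverse filter `C(s) / (c_oᵀ H_o(s))` as a stable system. -/
def invSys (hco : S.IsMinPhaseRelDegOne co) : StableSys :=
  StableSys.mk _ (hS.exists_isImpulseResponse_C_div_coHo hco)

lemma realizes_invSys_mul_const (hco : S.IsMinPhaseRelDegOne co) (i : Fin n) :
    (hS.invSys hco * StableSys.const (co i)).Realizes fun s =>
      S.C s * (1 / S.coHo co s) * (co i : ℂ) := fun _ => rfl

lemma invSys_mul_sum (hco : S.IsMinPhaseRelDegOne co) :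
    hS.invSys hco * ∑ i, StableSys.const (co i) * hS.Hosys i = hS.Csys :=
  StableSys.ext_evalHom fun s => by
    have hoHo : StableSys.evalHom s (∑ i, StableSys.const (co i) * hS.Hosys i) = S.coHo co s := by
      simp only [map_sum, map_mul, (StableSys.realizes_const _).evalHom_eq,
        (hS.realizes_Hosys _).evalHom_eq, coHo, dotProduct]
    have hinv : StableSys.evalHom s (hS.invSys hco) = S.C s * (1 / S.coHo co s) := rfl
    rw [map_mul, hoHo, hinv, hS.realizes_Csys.evalHom_eq, mul_one_div,
      div_mul_cancel₀ _ (hco.coHo_ne_zero s.2)]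

lemma ofReal_sqrt_Γc_ne_zero : ENNReal.ofReal √S.Γc ≠ 0 :=
  (ENNReal.ofReal_pos.2 (Real.sqrt_pos.2 hS.Γc_pos)).ne'

lemma γ₁_lt_top (hgain : S.GainCondition) : S.γ₁ < ∞ :=
  ENNReal.mul_lt_top
    (l1Gain_lt_top fun i j => (hS.realizes_H2sys hgain i j).exists_isImpulseResponse)
    ENNReal.ofReal_lt_top

lemma γ₂_lt_top (hgain : S.GainCondition) (hco : S.IsMinPhaseRelDegOne co) : S.γ₂ co < ∞ :=
  ENNReal.add_lt_top.2
    ⟨ENNReal.mul_lt_top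
      (l1Gain_lt_top fun _ j => (hS.realizes_invSys_mul_const hco j).exists_isImpulseResponse)
      ENNReal.ofReal_lt_top,
    ENNReal.mul_lt_top
      (l1Gain_lt_top fun _ j => (hS.realizes_feedbackSys j).exists_isImpulseResponse)
      (hS.γ₁_lt_top hgain)⟩

lemma eq_Hosys_smul {z : ℝ → Fin n → ℝ} {f : Sig} (hz0 : z 0 = 0)
    (hz : ∀ t, 0 ≤ t → HasDerivWithinAt z (S.Am *ᵥ z t + f t • S.b) (Ici 0) t)
    {Z : Fin n → Sig} (hZ : ∀ i t, 0 ≤ t → Z i t = z t i) (i : Fin n) :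
    Z i = hS.Hosys i • f := by
  have hderiv (i : Fin n) (t : ℝ) (ht : 0 ≤ t) : HasDerivWithinAt (Z i)
      (∑ j, S.Am i j * Z j t + (StableSys.const (S.b i) • f) t) (Ici 0) t := by
    refine ((hasDerivWithinAt_pi.1 (hz t ht) i).congr (fun τ hτ => hZ i τ hτ)
      (hZ i t ht)).congr_deriv ?_
    simp only [StableSys.const_smul, Sig.smul_apply, hZ _ t ht, Pi.add_apply, Pi.smul_apply,
      smul_eq_mul, Matrix.mulVec, dotProduct, mul_comm (f t)]
  rw [hS.hurwitz.eq_sum_resolvent_smul (fun i => by rw [hZ i 0 le_rfl, hz0]; rfl) hderiv i, Hosys,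
    Matrix.mulVec, dotProduct, Finset.sum_smul]
  simp only [mul_smul]

end Admissible

end Setup

namespace Setup

/-! ### Comparison with the reference system -/

variable {n : ℕ} {S : Setup n} {x xhat θhat xref : ℝ → Fin n → ℝ} {u u₂ uref : ℝ → ℝ}
  {co : Fin n → ℝ}

lemma IsReference.continuousOn (hr : S.IsReference xref uref) : ContinuousOn xref (Ici 0) :=
  fun t ht => (hr.plant.2 t ht).continuousWithinAt

namespace IsClosedLoop

variable (hS : S.Admissible) (hx : S.IsClosedLoop x xhat θhat u u₂) (hr : S.IsReference xref uref)

include hx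

/-- The prediction error `x̃ = x̂ - x` as a signal. -/
def predictionError (i : Fin n) : Sig :=
  Sig.of (fun t => (xhat t - x t) i) (continuousOn_pi.1 hx.continuousOn_error i)

lemma predictionError_apply (i : Fin n) {t : ℝ} (ht : 0 ≤ t) :
    hx.predictionError i t = (xhat t - x t) i := Sig.of_apply _ ht

/-- The disturbance `(θ̂ - θ)ᵀ x` that the parameter error induces, as a signal. -/
def mismatch : Sig :=
  Sig.of (fun t => (θhat t - S.θ) ⬝ᵥ x t)
    (continuousOn_dotProduct (hx.continuousOn_estimate.sub continuousOn_const) hx.continuousOn)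

lemma mismatch_apply {t : ℝ} (ht : 0 ≤ t) : hx.mismatch t = (θhat t - S.θ) ⬝ᵥ x t :=
  Sig.of_apply _ ht

include hr in
/-- The tracking error `e = x - x_ref` as a signal. -/
def trackingError (i : Fin n) : Sig :=
  Sig.of (fun t => (x t - xref t) i)
    (continuousOn_pi.1 (hx.continuousOn.sub hr.continuousOn) i)

lemma trackingError_apply (i : Fin n) {t : ℝ} (ht : 0 ≤ t) :
    hx.trackingError hr i t = (x t - xref t) i := Sig.of_apply _ ht

lemma sum_const_smul_trackingError_apply (a : Fin n → ℝ) {t : ℝ} (ht : 0 ≤ t) :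
    (∑ j, StableSys.const (a j) • hx.trackingError hr j) t = a ⬝ᵥ (x t - xref t) := by
  rw [StableSys.sum_const_smul_apply]
  simp only [hx.trackingError_apply hr _ ht]

lemma predictionError_eq (i : Fin n) :
    hx.predictionError i = -(hS.Hosys i • hx.mismatch) := by
  rw [← smul_neg]
  refine hS.eq_Hosys_smul (z := fun t => xhat t - x t) ?_ (fun t ht => ?_)
    (fun i t ht => hx.predictionError_apply i ht) i
  · rw [hx.predictor_init, hx.plant.1, sub_self]
  · rw [Sig.neg_apply, hx.mismatch_apply ht]
    exact hx.hasDerivWithinAt_error ht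

lemma filter_sub_eq {t : ℝ} (ht : 0 ≤ t) :
    u₂ t - (uref t + S.K ⬝ᵥ xref t) =
      (hS.Csys • (∑ j, StableSys.const (S.θ j) • hx.trackingError hr j + hx.mismatch)) t := by
  have hW : ContinuousOn (fun t => θhat t ⬝ᵥ x t + S.kg * S.r t) (Ici 0) :=
    (continuousOn_dotProduct hx.continuousOn_estimate hx.continuousOn).add
      (continuousOn_const.mul hS.r_continuous)
  have hWref : ContinuousOn (fun t => S.kg * S.r t + S.θ ⬝ᵥ xref t) (Ici 0) :=
    (continuousOn_const.mul hS.r_continuous).add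
      (continuousOn_dotProduct continuousOn_const hr.continuousOn)
  have hinput : ∑ j, StableSys.const (S.θ j) • hx.trackingError hr j + hx.mismatch =
      Sig.of _ hW - Sig.of _ hWref := Sig.ext_nonneg fun t ht => by
    rw [Sig.add_apply, Sig.sub_apply, hx.sum_const_smul_trackingError_apply hr _ ht,
      hx.mismatch_apply ht, Sig.of_apply _ ht, Sig.of_apply _ ht, dotProduct_sub, sub_dotProduct]
    ring
  rw [hinput, smul_sub, Sig.sub_apply,
    hx.filtered.eq_smul hS.realizes_Csys (fun _ => Sig.of_apply hW) ht,
    hr.control.eq_smul hS.realizes_Csys (fun _ => Sig.of_apply hWref) ht]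

lemma trackingError_eq_Hosys_smul (i : Fin n) :
    hx.trackingError hr i = hS.Hosys i •
      (hS.Csys • (∑ j, StableSys.const (S.θ j) • hx.trackingError hr j + hx.mismatch) -
        ∑ j, StableSys.const (S.θ j) • hx.trackingError hr j) := by
  refine hS.eq_Hosys_smul (z := fun t => x t - xref t) ?_ (fun t ht => ?_)
    (fun i t ht => hx.trackingError_apply hr i ht) i
  · rw [hr.plant.1, hx.plant.1, sub_self]
  · refine ((hx.hasDerivWithinAt ht).sub (hr.plant.2 t ht)).congr_deriv ?_
    rw [Sig.sub_apply, hx.sum_const_smul_trackingError_apply hr _ ht,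
      ← hx.filter_sub_eq hS hr ht, dotProduct_sub, Matrix.mulVec_sub, Am_mulVec (xref t)]
    module

open scoped Matrix.Module in
lemma trackingError_eq (hgain : S.GainCondition) (i : Fin n) :
    hx.trackingError hr i = -∑ j, hS.H2sys hgain i j • hx.predictionError j := by
  have hloop (i : Fin n) : hx.trackingError hr i =
      hS.Gsys i • ∑ j, StableSys.const (S.θ j) • hx.trackingError hr j +
        -(hS.Csys • hx.predictionError i) := by
    nth_rewrite 1 [hx.trackingError_eq_Hosys_smul hS hr i]
    rw [hx.predictionError_eq hS i, Admissible.Gsys]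
    module
  rw [eq_smul_of_eq_smul_sum_add (hS.sens_mul hgain) hloop, Matrix.Module.smul_apply,
    ← Finset.sum_neg_distrib]
  refine Finset.sum_congr rfl fun j _ => ?_
  rw [Admissible.H2sys, Matrix.smul_apply, smul_eq_mul, mul_comm, mul_smul, smul_neg]

lemma Csys_smul_mismatch (hco : S.IsMinPhaseRelDegOne co) :
    hS.Csys • hx.mismatch =
      -∑ i, (hS.invSys hco * StableSys.const (co i)) • hx.predictionError i := by
  rw [← hS.invSys_mul_sum hco, Finset.mul_sum, Finset.sum_smul, ← Finset.sum_neg_distrib]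
  refine Finset.sum_congr rfl fun i _ => ?_
  rw [hx.predictionError_eq hS i, smul_neg, neg_neg, ← mul_smul, mul_assoc]

lemma control_sub_eq (hco : S.IsMinPhaseRelDegOne co) {t : ℝ} (ht : 0 ≤ t) :
    u t - uref t = (∑ j, hS.feedbackSys j • hx.trackingError hr j) t -
      (∑ j, (hS.invSys hco * StableSys.const (co j)) • hx.predictionError j) t := by
  have hfeedback : ∑ j, hS.feedbackSys j • hx.trackingError hr j =
      hS.Csys • ∑ j, StableSys.const (S.θ j) • hx.trackingError hr j -
        ∑ j, StableSys.const (S.K j) • hx.trackingError hr j := by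
    simp only [Admissible.feedbackSys, sub_smul, mul_smul, Finset.sum_sub_distrib,
      Finset.smul_sum]
  have hu : u t - uref t = (u₂ t - (uref t + S.K ⬝ᵥ xref t)) - S.K ⬝ᵥ (x t - xref t) := by
    rw [hx.control t ht, dotProduct_sub]
    ring
  rw [hu, hx.filter_sub_eq hS hr ht, ← hx.sum_const_smul_trackingError_apply hr S.K ht, smul_add,
    hx.Csys_smul_mismatch hS hco, hfeedback]
  simp only [Sig.add_apply, Sig.sub_apply, Sig.neg_apply]
  ring

/-! ### The performance bounds -/

include hS in
lemma ofReal_abs_predictionError_le (hn : 1 ≤ n) (i : Fin n) (t : ℝ) (ht : 0 ≤ t) :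
    ENNReal.ofReal |hx.predictionError i t| ≤
      ENNReal.ofReal √(S.thetaBarMax / lambdaMin S.P) / ENNReal.ofReal √S.Γc := by
  rw [hx.predictionError_apply i ht, ← ENNReal.ofReal_div_of_pos (Real.sqrt_pos.2 hS.Γc_pos)]
  exact ENNReal.ofReal_le_ofReal (hx.abs_error_le hn hS ht i)

include hS in
lemma ofReal_abs_trackingError_le (hn : 1 ≤ n) (hgain : S.GainCondition) (i : Fin n) (t : ℝ) :
    ENNReal.ofReal |hx.trackingError hr i t| ≤ S.γ₁ / ENNReal.ofReal √S.Γc := by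
  rw [hx.trackingError_eq hS hr hgain i, Sig.neg_apply, abs_neg, γ₁, mul_div_assoc]
  exact ofReal_abs_sum_smul_le (H := S.H2) (hS.realizes_H2sys hgain i)
    (ENNReal.div_ne_top ENNReal.ofReal_ne_top hS.ofReal_sqrt_Γc_ne_zero)
    (hx.ofReal_abs_predictionError_le hS hn) t

include hS hr in
lemma linftyNorm_state_sub_le (hn : 1 ≤ n) (hgain : S.GainCondition) :
    linftyNorm (fun t => x t - xref t) ≤ S.γ₁ / ENNReal.ofReal √S.Γc :=
  linftyNorm_le fun i t ht => by
    rw [← hx.trackingError_apply hr i ht]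
    exact hx.ofReal_abs_trackingError_le hS hr hn hgain i t

include hS hr in
lemma linftyNorm_output_sub_le (hn : 1 ≤ n) (hgain : S.GainCondition) {y yref : ℝ → ℝ}
    (hy : ∀ t, 0 ≤ t → y t = S.c ⬝ᵥ x t) (hyref : ∀ t, 0 ≤ t → yref t = S.c ⬝ᵥ xref t) :
    linftyNorm (fun t (_ : Unit) => y t - yref t) ≤ S.cGain * S.γ₁ / ENNReal.ofReal √S.Γc :=
  linftyNorm_le fun i t ht => by
    rw [hy t ht, hyref t ht, ← dotProduct_sub, ← hx.sum_const_smul_trackingError_apply hr S.c ht,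
      mul_div_assoc]
    exact ofReal_abs_sum_smul_le (i := i) (fun j => StableSys.realizes_const (S.c j))
      (ENNReal.div_ne_top (hS.γ₁_lt_top hgain).ne hS.ofReal_sqrt_Γc_ne_zero)
      (fun j t _ => hx.ofReal_abs_trackingError_le hS hr hn hgain j t) t

include hS hr in
lemma linftyNorm_control_sub_le (hn : 1 ≤ n) (hgain : S.GainCondition)
    (hco : S.IsMinPhaseRelDegOne co) :
    linftyNorm (fun t (_ : Unit) => u t - uref t) ≤ S.γ₂ co / ENNReal.ofReal √S.Γc :=
  linftyNorm_le fun i t ht => by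
    have hΓ := hS.ofReal_sqrt_Γc_ne_zero
    rw [hx.control_sub_eq hS hr hco ht, γ₂, ENNReal.add_div, mul_div_assoc, mul_div_assoc,
      add_comm]
    refine (ENNReal.ofReal_le_ofReal (abs_sub _ _)).trans ?_
    rw [ENNReal.ofReal_add (abs_nonneg _) (abs_nonneg _)]
    gcongr
    · exact ofReal_abs_sum_smul_le (i := i) hS.realizes_feedbackSys
        (ENNReal.div_ne_top (hS.γ₁_lt_top hgain).ne hΓ)
        (fun j t _ => hx.ofReal_abs_trackingError_le hS hr hn hgain j t) t
    · exact ofReal_abs_sum_smul_le (i := i) (hS.realizes_invSys_mul_const hco)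
        (ENNReal.div_ne_top ENNReal.ofReal_ne_top hΓ) (hx.ofReal_abs_predictionError_le hS hn) t

end IsClosedLoop

end Setup

end L1Adaptive

end

theorem theorem3_general {n : ℕ} (hn : 1 ≤ n) (S : L1Adaptive.Setup n) (hS : S.Admissible)
    (hgain : S.GainCondition)
    (x xhat θhat : ℝ → Fin n → ℝ) (u u₂ y : ℝ → ℝ)
    (hx : S.IsClosedLoop x xhat θhat u u₂) (hy : ∀ t, 0 ≤ t → y t = S.c ⬝ᵥ x t)
    (xref : ℝ → Fin n → ℝ) (uref yref : ℝ → ℝ)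
    (hxref : S.IsReference xref uref) (hyref : ∀ t, 0 ≤ t → yref t = S.c ⬝ᵥ xref t) :
    (S.γ₁ < ∞ ∧
      L1Adaptive.linftyNorm (fun t => x t - xref t) ≤ S.γ₁ / ENNReal.ofReal √S.Γc) ∧
    L1Adaptive.linftyNorm (fun t (_ : Unit) => y t - yref t) ≤
      S.cGain * S.γ₁ / ENNReal.ofReal √S.Γc ∧
    (∃ co : Fin n → ℝ, S.IsMinPhaseRelDegOne co) ∧
    ∀ co : Fin n → ℝ, S.IsMinPhaseRelDegOne co →
      S.γ₂ co < ∞ ∧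
        L1Adaptive.linftyNorm (fun t (_ : Unit) => u t - uref t) ≤
          S.γ₂ co / ENNReal.ofReal √S.Γc :=
  ⟨⟨hS.γ₁_lt_top hgain, hx.linftyNorm_state_sub_le hS hxref hn hgain⟩,
    hx.linftyNorm_output_sub_le hS hxref hn hgain hy hyref,
    L1Adaptive.Setup.exists_isMinPhaseRelDegOne hn hS.controllable hS.hurwitz,
    fun _ hco => ⟨hS.γ₂_lt_top hgain hco, hx.linftyNorm_control_sub_le hS hxref hn hgain hco⟩⟩

theorem theorem3 {n : ℕ} (hn : 1 ≤ n) (S : L1Adaptive.Setup n) (hS : S.Standing)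
    (hgain : S.GainCondition)
    (x xhat θhat : ℝ → Fin n → ℝ) (u u₂ y : ℝ → ℝ)
    (hx : S.IsClosedLoop x xhat θhat u u₂) (hy : ∀ t, 0 ≤ t → y t = S.c ⬝ᵥ x t)
    (xref : ℝ → Fin n → ℝ) (uref yref : ℝ → ℝ)
    (hxref : S.IsReference xref uref) (hyref : ∀ t, 0 ≤ t → yref t = S.c ⬝ᵥ xref t) :
    (S.γ₁ < ∞ ∧
      L1Adaptive.linftyNorm (fun t => x t - xref t) ≤ S.γ₁ / ENNReal.ofReal √S.Γc) ∧
    L1Adaptive.linftyNorm (fun t (_ : Unit) => y t - yref t) ≤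
      S.cGain * S.γ₁ / ENNReal.ofReal √S.Γc ∧
    (∃ co : Fin n → ℝ, S.IsMinPhaseRelDegOne co) ∧
    ∀ co : Fin n → ℝ, S.IsMinPhaseRelDegOne co →
      S.γ₂ co < ∞ ∧
        L1Adaptive.linftyNorm (fun t (_ : Unit) => u t - uref t) ≤
          S.γ₂ co / ENNReal.ofReal √S.Γc :=
  theorem3_general hn S hS.admissible hgain x xhat θhat u u₂ y hx hy xref uref yref hxref hyref
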